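/- **Setting.** Write $\kappa(k,q)=e^{\langle k,q\rangle/\sqrt d}$ for $k,q\in\mathbb R^d$, and $\|\cdot\|$ for the Euclidean norm. Collections of pairs are counted with multiplicity. *SoftmaxBalance* takes a finite sequence $B$ of pairs $(k,v)\in\mathbb R^d\times\mathbb R^s$, radii $r_{\rm key},r_{\rm value}$ and $\delta>0$, where $n$ bounds the number of pairs. With $R=e^{r_{\rm key}^2/(2\sqrt d)}\,r_{\rm value}$ and $c=30\log(n/\delta)$, it goes through $B$ and for the $j$-th pair computes $z=\sum_{i<j}\eta_i\,\kappa(k_i,k_j)\langle v_i,v_j\rangle$; if $|z|>cR^2$ it FAILS, otherwise it draws $\eta_j=+1$ with probability $\frac12-\frac{z}{2cR^2}$ and $\eta_j=-1$ otherwise (a fair coin if $cR^2=0$). It outputs the smaller of the classes $\{\eta=+1\}$, $\{\eta=-1\}$ (the first one in case of a tie). *MergeAndReduce* with batch size $t$, number of levels $T$, key radius $r$ and failure parameter $\delta$ keeps collections $C^0,\dots,C^T$, initially empty. At step $j$ it adds $(k_j,v_j)$ to $C^0$. If $t\mid j$, it puts $p=j/t$, $i=0$, and, while $p$ is an integer and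 $i<T$, it adds to $C^{i+1}$ the output of SoftmaxBalance (with fresh coins) on $C^i$ with radii $r$ and $\max_{(k,v)\in C^i}\|v\|$ and parameter $\delta$, empties $C^i$, and replaces $i$ by $i+1$ and $p$ by $p/2$. Then it outputs $C^0,\dots,C^T$. If a call FAILS, it outputs nothing from then on. Time and memory are those of a real RAM: a scalar operation (arithmetic, $\exp$, $\log$, square root, comparison, biased coin flip), and writing, releasing or outputting one word, costs one unit of time. Memory is the largest number of words in use at any moment, one word holding one real number or counter. **Theorem.** There are exponents $m,m'\in\mathbb N$ such that for every $a\in\mathbb N$ there are $b\in\mathbb N$ and $K,K'>0$ with the following property. Let $n\ge 2$, $1\le s\le d$ be integers, let $r,\varepsilon>0$, and let $q_1,\dots,q_n,k_1,\dots,k_n\in\mathbb R^d$ and $v_1,\dots,v_n\in\mathbb R^s$ with $\|q_j\|,\|k_j\|\le r$ for all $j$. Run MergeAndReduce on the stream $(k_1,v_1),\dots,(k_n,v_n)$ with key radius $r$, $$t=\left\lceil K(\log n)^m\,\frac{\sqrt s\,e^{2r^2/\sqrt d}}{\varepsilon}\right\rceil,\qquad T=\max\{0,\lceil\log_2(n/t)\rceil\},\qquad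 \delta=n^{-b}.$$ 1. With probability at least $1-n^{-a}$, for every step $j\in\{1,\dots,n\}$ simultaneously, no call has failed and the output $C^0,\dots,C^T$ of step $j$ satisfies $$\Bigl\|\sum_{i=1}^j\kappa(k_i,q_j)v_i-\sum_{i=0}^T2^i\sum_{(k,v)\in C^i}\kappa(k,q_j)v\Bigr\|\le\varepsilon j\,e^{-r^2/\sqrt d}\max_{i\in[n]}\|v_i\|.$$ 2. For every outcome of the coins and every step $j$, the output $C^0,\dots,C^T$ (if there is one) consists of disjoint subcollections of $(k_1,v_1),\dots,(k_j,v_j)$; the memory used up to step $j$ is at most $$K'(\log n)^{m'}\,d\,\max\Bigl\{1,\frac{\sqrt s\,e^{2r^2/\sqrt d}}{\varepsilon}\Bigr\};$$ and the running time of step $j$ is at most $$K'(\log n)^{m'}\,d\,\max\Bigl\{1,\frac{s\,e^{4r^2/\sqrt d}}{\varepsilon^2}\Bigr\}.$$ -/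

import Mathlib

noncomputable section

/-! ### A metered real random access machine with biased coins

Programs are written in a state monad over probability mass functions.  Every scalar operation
(arithmetic, `exp`, `log`, `sqrt`, comparison, one biased coin flip) and every word that is written
or released costs one unit of time; storage is counted in words, one word holding one real number
or one counter or pointer. -/

namespace RealRAM

/-- Resource counters: elapsed time, words in use now, largest number of words ever in use. -/
structure Meter where
  time : ℕ
  live : ℕ
  peak : ℕ

/-- A randomized computation with metered resources. -/
abbrev Comp (α : Type) : Type := StateT Meter PMF α

/-- Spend `c` units of time. -/
def tick (c : ℕ) : Comp Unit :=
  fun m => PMF.pure ((), ⟨m.time + c, m.live, m.peak⟩)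

/-- Reserve and write `w` words. -/
def alloc (w : ℕ) : Comp Unit :=
  fun m => PMF.pure ((), ⟨m.time + w, m.live + w, max m.peak (m.live + w)⟩)

/-- Release `w` words. -/
def free (w : ℕ) : Comp Unit :=
  fun m => PMF.pure ((), ⟨m.time + w, m.live - w, m.peak⟩)

def add (x y : ℝ) : Comp ℝ := do tick 1; pure (x + y)
def sub (x y : ℝ) : Comp ℝ := do tick 1; pure (x - y)
def mul (x y : ℝ) : Comp ℝ := do tick 1; pure (x * y)
def div (x y : ℝ) : Comp ℝ := do tick 1; pure (x / y)
def exp (x : ℝ) : Comp ℝ := do tick 1; pure (Real.exp x)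
def log (x : ℝ) : Comp ℝ := do tick 1; pure (Real.log x)
def sqrt (x : ℝ) : Comp ℝ := do tick 1; pure (Real.sqrt x)
def abs (x : ℝ) : Comp ℝ := do tick 1; pure |x|
def maximum (x y : ℝ) : Comp ℝ := do tick 1; pure (max x y)

open Classical in
/-- The comparison `x < y`. -/
def less (x y : ℝ) : Comp Bool := do tick 1; pure (decide (x < y))

/-- The law of a coin that shows `true` with probability `p`, for `p ∈ [0, 1]`
(`p` is clamped to `[0, 1]` only to make the definition total). -/
def coin (p : ℝ) : PMF Bool :=
  PMF.ofFintype
    (fun b => ENNReal.ofReal (cond b (max 0 (min 1 p)) (1 - max 0 (min 1 p)))) (by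
      have h1 : max 0 (min 1 p) ≤ 1 := max_le zero_le_one (min_le_left _ _)
      have h0 : 0 ≤ max 0 (min 1 p) := le_max_left _ _
      rw [Fintype.sum_bool, cond_true, cond_false,
        ← ENNReal.ofReal_add h0 (sub_nonneg.2 h1)]
      simp)

/-- Flip a coin with success probability `p`. -/
def flip (p : ℝ) : Comp Bool := do
  tick 1
  (fun m => (coin p).map fun b => (b, m) : Comp Bool)

/-- Inner product of two vectors, computed coordinate by coordinate. -/
def dot {m : ℕ} (x y : EuclideanSpace ℝ (Fin m)) : Comp ℝ :=
  (List.finRange m).foldlM (fun acc i => do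
    let a ← mul (x i) (y i)
    add acc a) 0

end RealRAM

namespace KVCache

open RealRAM

/-- A key-value pair `(k, v)` with `k ∈ ℝ^d` and `v ∈ ℝ^s`; it occupies `d + s` words. -/
abbrev KV (d s : ℕ) : Type := EuclideanSpace ℝ (Fin d) × EuclideanSpace ℝ (Fin s)

variable {d s : ℕ}

/-- `exp(⟨k, q⟩ / √d)`. -/
def softmaxKernel (k q : EuclideanSpace ℝ (Fin d)) : ℝ :=
  Real.exp (inner ℝ k q / Real.sqrt d)

/-! ### SoftmaxBalance -/

/-- The real number `+1` or `-1` denoted by a sign bit. -/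
def signValue (b : Bool) : ℝ := if b then 1 else -1

/-- The scalar `yᵀη`, where `y_i = exp(⟨k_i, k_j⟩ / σ) ⟨v_i, v_j⟩` and `η_i` is the sign already
given to the `i`-th pair; `x` is the pair `(k_j, v_j)` and `σ` holds the value `√d`.
(The not yet signed pair `j` has `η_j = 0` and does not contribute.) -/
def correlation (σ : ℝ) (signed : List (KV d s × Bool)) (x : KV d s) : Comp ℝ :=
  signed.foldlM (fun acc y => do
    let a ← dot y.1.1 x.1
    let b ← div a σ
    let e ← exp b
    let g ← dot y.1.2 x.2
    let w ← mul e g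
    let u ← mul w (signValue y.2)
    add acc u) 0

/-- The main loop of SoftmaxBalance: the pairs of the first list still have to be signed, those of
the second one are signed; `thr` holds `c R²`.  The result `none` stands for FAIL. -/
def assignSigns (σ thr : ℝ) :
    List (KV d s) → List (KV d s × Bool) → Comp (Option (List (KV d s × Bool)))
  | [], signed => pure (some signed)
  | x :: xs, signed => do
    let z ← correlation σ signed x
    let z' ← abs z
    let bad ← less thr z'
    if bad then pure none
    else do
      let D ← mul 2 thr
      let f ← div z D
      let p ← sub (1 / 2) f
      let η ← flip p
      assignSigns σ thr xs (signed ++ [(x, η)])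

/-- The smaller one of the two sign classes (the positive one in case of a tie). -/
def smallerClass (signed : List (KV d s × Bool)) : List (KV d s) :=
  let plus := (signed.filter fun y => y.2).map Prod.fst
  let minus := (signed.filter fun y => !y.2).map Prod.fst
  if plus.length ≤ minus.length then plus else minus

/-- SoftmaxBalance on the pairs `B` with radii `rkey`, `rval`, failure parameter `δ` and the bound
`n` on the number of pairs.  Its work space is one word for each sign and sixteen registers; the
selected pairs are written to newly reserved words. -/
def softmaxBalance (n : ℕ) (rkey rval δ : ℝ) (B : List (KV d s)) :
    Comp (Option (List (KV d s))) := do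
  alloc (B.length + 16)
  let σ ← sqrt d
  -- `R = exp(rkey² / (2 √d)) * rval`
  let a₁ ← mul rkey rkey
  let a₂ ← mul 2 σ
  let a₃ ← div a₁ a₂
  let a₄ ← exp a₃
  let R ← mul a₄ rval
  -- `c = 30 log(n / δ)`
  let b₁ ← div n δ
  let b₂ ← log b₁
  let c ← mul 30 b₂
  let R₂ ← mul R R
  let thr ← mul c R₂
  let res ← assignSigns σ thr B []
  match res with
  | none => do
    free (B.length + 16)
    pure none
  | some signed => do
    -- count the signs, then copy the smaller class
    tick (2 * signed.length)
    let out := smallerClass signed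
    alloc ((d + s) * out.length)
    free (B.length + 16)
    pure (some out)

/-! ### MergeAndReduce -/

/-- The largest Euclidean norm of a value vector in `B`. -/
def valueRadius (B : List (KV d s)) : Comp ℝ :=
  B.foldlM (fun acc x => do
    let a ← dot x.2 x.2
    let b ← sqrt a
    maximum acc b) 0

/-- Parameters: bound `n` on the length of the stream, batch size `t`, number `T` of compression
levels, bound `r` on the norms of the keys, failure parameter `δ` of the calls to
SoftmaxBalance. -/
structure Params where
  n : ℕ
  t : ℕ
  T : ℕ
  r : ℝ
  δ : ℝ

/-- The level subsets `C^0, C^1, …` (only those with index at most `T` are ever used).  They are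
lists, so that a pair that occurs twice in the stream is counted twice. -/
abbrev Levels (d s : ℕ) : Type := ℕ → List (KV d s)

/-- The while loop of MergeAndReduce, entered at level `i` with the integer `p`.
The first argument is `T - i`; the loop ends when `i = T` or when `p / 2` is not an integer. -/
def cascade (P : Params) : ℕ → ℕ → ℕ → Levels d s → Comp (Option (Levels d s))
  | 0, _, _, C => pure (some C)
  | m + 1, i, p, C => do
    let rval ← valueRadius (C i)
    let res ← softmaxBalance P.n P.r rval P.δ (C i)
    match res with
    | none => pure none
    | some out => do
      -- `C^{i+1} ← C^{i+1} ∪ out`, then `C^i ← ∅`, `i ← i + 1`, `p ← p / 2`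
      free ((d + s) * (C i).length)
      let C' := Function.update (Function.update C (i + 1) (C (i + 1) ++ out)) i []
      tick 5
      if 2 ∣ p then cascade P m (i + 1) (p / 2) C' else pure (some C')

/-- The number `j` of tokens read so far, and the level subsets; `none` after a FAIL. -/
structure State (d s : ℕ) where
  j : ℕ
  levels : Option (Levels d s)

/-- One iteration of MergeAndReduce, on the token `x`.  The last charge pays for writing out
`C^0, …, C^T` word by word. -/
def step (P : Params) (x : KV d s) (st : State d s) : Comp (State d s) :=
  match st.levels with
  | none => do
    tick 1
    pure ⟨st.j + 1, none⟩
  | some C => do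
    alloc (d + s)
    let C₀ := Function.update C 0 (C 0 ++ [x])
    let j := st.j + 1
    tick 4
    let res ← if P.t ∣ j then cascade P P.T 0 (j / P.t) C₀ else pure (some C₀)
    match res with
    | none => pure ⟨j, none⟩
    | some C' => do
      tick (∑ i ∈ Finset.range (P.T + 1), ((d + s) * (C' i).length + 1))
      pure ⟨j, some C'⟩

/-- What is observed at the end of one iteration: the level subsets that are output (`none` after
a FAIL), the running time of the iteration, and the largest number of words in use so far. -/
structure Record (d s : ℕ) where
  output : Option (Levels d s)
  time : ℕ
  peak : ℕ

/-- Feed a list of tokens to the algorithm and record every iteration. -/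
def trace (P : Params) : List (KV d s) → State d s → Meter → PMF (List (Record d s))
  | [], _, _ => PMF.pure []
  | x :: xs, st, m =>
    (step P x st m).bind fun y =>
      (trace P xs y.1 y.2).map fun l => ⟨y.1.levels, y.2.time - m.time, y.2.peak⟩ :: l

/-- MergeAndReduce, started with empty level subsets.  In the beginning the memory holds the
`T + 1` headers of the level subsets and 24 words for parameters, counters and scratch registers. -/
def mergeAndReduce (P : Params) (stream : List (KV d s)) : PMF (List (Record d s)) :=
  trace P stream ⟨0, some fun _ => []⟩ ⟨0, P.T + 25, P.T + 25⟩

/-- The estimate `∑_{i ≤ T} 2^i ∑_{(k, v) ∈ C^i} exp(⟨k, q⟩ / √d) v`. -/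
def estimate (T : ℕ) (C : Levels d s) (q : EuclideanSpace ℝ (Fin d)) :
    EuclideanSpace ℝ (Fin s) :=
  ∑ i ∈ Finset.range (T + 1),
    (2 : ℝ) ^ i • ((C i).map fun x => softmaxKernel x.1 q • x.2).sum

/-- The batch size `⌈K (log n)^m √s e^{2r²/√d} / ε⌉`. -/
def batchSize (K : ℝ) (m n d s : ℕ) (r ε : ℝ) : ℕ :=
  ⌈K * Real.log n ^ m * (Real.sqrt s * Real.exp (2 * r ^ 2 / Real.sqrt d) / ε)⌉₊

/-- The parameters of MergeAndReduce for a stream of length `n`: batch size `t`,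
`T = log₂(n / t)` rounded up (and `T = 0` when `t ≥ n`), and `δ = n^{-b}`. -/
def paramsFor (n t b : ℕ) (r : ℝ) : Params where
  n := n
  t := t
  T := ⌈Real.logb 2 ((n : ℝ) / t)⌉₊
  r := r
  δ := 1 / (n : ℝ) ^ b

end KVCache

end

noncomputable section

open scoped ENNReal

namespace KVCache

/-! ### Elementary inequalities -/

section Inequalities

open MeasureTheory ProbabilityTheory

/-! SoftmaxBalance is the self-balancing walk in the feature space of the kernel κ(k,q)⟨v,e⟩. That
space is modelled by formal combinations of pairs with the semidefinite form `kvForm`; positivity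
comes from the exponential series (`kvForm_self_nonneg`). The scalar z is the pairing of the current
signed sum with the new pair, so FAIL and a large error at a query are both statements about linear
functionals of the walk.

The walk is analysed backwards in time. Suppose a sum of exponentials exp(B(w,u)+e) dominates the
probability of a bad outcome after a step. Averaging over the biased sign and applying Hoeffding's
lemma gives exponentials again, with u corrected by the drift, and the mass ∑ exp(e+θ‖u‖²/2), a
Gaussian mean, does not grow (`exists_expSum_step`). A possible FAIL at a pair costs two more
exponentials of mass at most exp(-c/2) each. The walk starts at 0, where the sum is at most its
mass; this gives failure probability at most (N+|B|)·2exp(-c/2) for N queries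
(`exists_expSum_assignSigns`, `softmaxBalance_bad_le`). Vector-valued errors are detected by
averaging cosh over the s coordinates: convexity of cosh√ costs √s in the error, but no factor s in
the probability.

Halving level i changes the estimate by at most 2^i·E, where E = √s·c·exp(r²/√d)·V and V is the
largest value norm. Up to step j this happens at most j/(t·2^i) times, so the total error is at most
E·T·j/t (`totalWeight_mul_le`). The two logarithms in t pay for c and T. All queries are controlled
at every step, and a union bound over the calls finishes the accuracy claim.

For the resources, levels up to i < T represent only tokens read since level i was last emptied, so
their weight is at most j mod t·2^i. Hence every level holds at most t pairs whatever the coins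
show, and memory and time are of order (T+1)·d·t and (T+1)·d·t². -/

/-- Hoeffding's lemma for a random sign with mean `-x`. -/
theorem two_point_exp_le {x : ℝ} (hx : |x| ≤ 1) (a : ℝ) :
    (1 / 2 - x / 2) * Real.exp a + (1 / 2 + x / 2) * Real.exp (-a)
      ≤ Real.exp (-(x * a) + a ^ 2 / 2) := by
  obtain ⟨hx1, hx2⟩ := abs_le.1 hx
  have hp : 0 ≤ 1 / 2 - x / 2 := by linarith
  have hq : 0 ≤ 1 / 2 + x / 2 := by linarith
  set μ : Measure ℝ := ENNReal.ofReal (1 / 2 - x / 2) • Measure.dirac 1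
    + ENNReal.ofReal (1 / 2 + x / 2) • Measure.dirac (-1) with hμ
  have hprob : IsProbabilityMeasure μ := by
    constructor
    simp only [hμ, Measure.coe_add, Measure.coe_smul, Pi.add_apply, Pi.smul_apply, measure_univ,
      smul_eq_mul, mul_one]
    rw [← ENNReal.ofReal_add hp hq]
    norm_num
  have hint (f : ℝ → ℝ) :
      ∫ y, f y ∂μ = (1 / 2 - x / 2) * f 1 + (1 / 2 + x / 2) * f (-1) := by
    rw [hμ, integral_add_measure, integral_smul_measure, integral_smul_measure, integral_dirac,
      integral_dirac, ENNReal.toReal_ofReal hp, ENNReal.toReal_ofReal hq, smul_eq_mul, smul_eq_mul]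
    · exact (integrable_dirac (by simp)).smul_measure ENNReal.ofReal_ne_top
    · exact (integrable_dirac (by simp)).smul_measure ENNReal.ofReal_ne_top
  have hae : ∀ᵐ y ∂μ, (id y : ℝ) ∈ Set.Icc (-1 : ℝ) 1 := by
    rw [hμ, ae_add_measure_iff]
    constructor <;>
    · refine Measure.ae_smul_measure ((ae_dirac_iff ?_).2 ?_) _
      · exact measurableSet_Icc
      · norm_num
  -- The interval [-1, 1] has half-length 1, hence variance proxy 1. The bound concerns the centred
  -- variable; the mean -x is restored at the end.
  have h := (hasSubgaussianMGF_of_mem_Icc (μ := μ) (X := id) aemeasurable_id hae).mgf_le a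
  have hmean : ∫ y, id y ∂μ = -x := by rw [hint]; simp only [id]; ring
  rw [mgf, hmean, hint] at h
  have h2 : (((‖(1 : ℝ) - -1‖₊ / 2) ^ 2 : NNReal) : ℝ) = 1 := by
    push_cast
    norm_num
  rw [h2] at h
  simp only [id] at h
  calc _ = Real.exp (-(x * a)) * ((1 / 2 - x / 2) * Real.exp (a * (1 - -x)) +
        (1 / 2 + x / 2) * Real.exp (a * (-1 - -x))) := by
        rw [mul_add, mul_left_comm, mul_left_comm _ (1 / 2 + x / 2), ← Real.exp_add, ← Real.exp_add]
        congr 3 <;> ring_nf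
    _ ≤ Real.exp (-(x * a)) * Real.exp (1 * a ^ 2 / 2) := by gcongr
    _ = _ := by rw [← Real.exp_add, one_mul]

/-- Convexity of `y ↦ cosh √y`, in the form of Jensen's inequality for a uniform average. -/
theorem cosh_sqrt_mean_le {s : ℕ} (hs : 0 < s) (x : Fin s → ℝ) :
    Real.cosh (Real.sqrt ((∑ l, x l ^ 2) / s)) ≤ (∑ l, Real.cosh (x l)) / s := by
  have hs' : (0 : ℝ) < s := by exact_mod_cast hs
  have h0 : 0 ≤ (∑ l, x l ^ 2) / s := by positivity
  have h1 := Real.hasSum_cosh (Real.sqrt ((∑ l, x l ^ 2) / s))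
  have h2 : HasSum (fun n => (∑ l, x l ^ (2 * n) / ((2 * n).factorial : ℝ)) / s)
      ((∑ l, Real.cosh (x l)) / s) :=
    (hasSum_sum fun l _ => Real.hasSum_cosh (x l)).div_const _
  refine hasSum_le (fun n => ?_) h1 h2
  rw [pow_mul, Real.sq_sqrt h0, ← Finset.sum_div, div_right_comm]
  gcongr
  -- The cosh series has positive coefficients, so the power mean inequality can be applied term by
  -- term.
  have := Real.pow_arith_mean_le_arith_mean_pow Finset.univ (fun _ : Fin s => (1 / s : ℝ))
    (fun l => x l ^ 2) (fun _ _ => by positivity) (by simp [hs'.ne']) (fun _ _ => by positivity) n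
  rw [← Finset.mul_sum, ← Finset.mul_sum] at this
  simp only [← pow_mul] at this
  simpa only [one_div, div_eq_inv_mul, mul_one] using this

theorem exp_le_two_mul_cosh (x : ℝ) : Real.exp x ≤ 2 * Real.cosh x := by
  rw [Real.cosh_eq]; linarith [Real.exp_pos (-x)]

end Inequalities

/-! ### Sums of exponentials of linear functionals -/

section ExpSum

variable {W : Type*} [AddCommGroup W] [Module ℝ W] (B : W →ₗ[ℝ] W →ₗ[ℝ] ℝ)

/-- The function `w ↦ ∑ exp(⟨w, u⟩ + e)`, the sum being over the pairs `(u, e)` of a list. -/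
def expSum (L : List (W × ℝ)) (w : W) : ℝ :=
  (L.map fun p => Real.exp (B w p.1 + p.2)).sum

/-- The value `∑ exp(e + θ ‖u‖² / 2)`, which bounds the mean of `expSum` over a centred
subgaussian vector with variance proxy `θ`. -/
def expMass (θ : ℝ) (L : List (W × ℝ)) : ℝ :=
  (L.map fun p => Real.exp (p.2 + θ / 2 * B p.1 p.1)).sum

theorem expSum_append (L L' : List (W × ℝ)) (w : W) :
    expSum B (L ++ L') w = expSum B L w + expSum B L' w := by
  simp [expSum]

theorem expMass_append (θ : ℝ) (L L' : List (W × ℝ)) :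
    expMass B θ (L ++ L') = expMass B θ L + expMass B θ L' := by
  simp [expMass]

theorem expSum_nonneg (L : List (W × ℝ)) (w : W) : 0 ≤ expSum B L w :=
  List.sum_nonneg (by simp only [List.mem_map]; rintro _ ⟨p, -, rfl⟩; positivity)

variable {B}

/-- This is used at the start of the walk, where it converts a bound on the mass into a bound on a
probability. -/
theorem expSum_zero_le {θ : ℝ} (hθ : 0 ≤ θ) (hB : ∀ w, 0 ≤ B w w) (L : List (W × ℝ)) :
    expSum B L 0 ≤ expMass B θ L := by
  refine List.sum_le_sum fun p _ => Real.exp_le_exp.2 ?_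
  have := mul_nonneg (div_nonneg hθ zero_le_two) (hB p.1)
  rw [map_zero, LinearMap.zero_apply]
  linarith

/-- One step of the self-balancing walk: averaging a sum of exponentials over the biased sign of
`y` gives a function below a sum of exponentials of no larger mass. -/
theorem exists_expSum_step {θ : ℝ} (hθ : 0 ≤ θ) (hB : ∀ w, 0 ≤ B w w)
    (hsymm : ∀ w u, B w u = B u w) (y : W) (hy : B y y ≤ θ) (L : List (W × ℝ)) :
    ∃ L', expMass B θ L' ≤ expMass B θ L ∧ ∀ w, |B w y| ≤ θ →
      (1 / 2 - B w y / (2 * θ)) * expSum B L (w + y)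
        + (1 / 2 + B w y / (2 * θ)) * expSum B L (w - y) ≤ expSum B L' w := by
  induction L with
  | nil => exact ⟨[], le_rfl, fun w _ => by simp [expSum]⟩
  | cons p L ih =>
    obtain ⟨L', hL', h⟩ := ih
    obtain ⟨u, e⟩ := p
    -- The sign has mean -B(w,y)/θ, so the drift replaces B(w,u) by B(w, u - (B(y,u)/θ)y); the added
    -- constant is the Hoeffding term.
    refine ⟨(u - (B y u / θ) • y, e + B y u ^ 2 / 2) :: L', ?_, fun w hw => ?_⟩
    · simp only [expMass, List.map_cons, List.sum_cons] at hL' ⊢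
      refine add_le_add (Real.exp_le_exp.2 ?_) hL'
      simp only [map_sub, map_smul, LinearMap.sub_apply, LinearMap.smul_apply, smul_eq_mul,
        hsymm u y]
      -- For θ = 0 the quotient is 0 by convention. Then ‖y‖² = 0, and Cauchy–Schwarz makes B(y,u)
      -- vanish.
      rcases hθ.eq_or_lt with h0 | h0
      · subst h0
        have h1 : B y u ^ 2 ≤ B y y * B u u := by
          have := LinearMap.BilinForm.apply_mul_apply_le_of_forall_zero_le B hB y u
          rwa [hsymm u y, ← sq] at this
        have h2 : B y y = 0 := le_antisymm hy (hB y)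
        have h3 : B y u ^ 2 = 0 := le_antisymm (by simpa [h2] using h1) (sq_nonneg _)
        simp [h3]
      -- With b = B(y,u), shifting u lowers θ‖u‖²/2 by b² - b²‖y‖²/(2θ) ≥ b²/2, which pays for the
      -- constant b²/2 added to e.
      · have h1 : (B y u / θ) * (B y u / θ * B y y) * (θ / 2) ≤ B y u ^ 2 / 2 := by
          calc _ = B y u ^ 2 / 2 * (B y y / θ) := by field_simp
            _ ≤ B y u ^ 2 / 2 * 1 := by
              gcongr
              exact (div_le_one h0).2 hy
            _ = _ := mul_one _
        have h2 : θ / 2 * (B y u / θ * B y u) = B y u ^ 2 / 2 := by field_simp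
        linarith
    · have hx : |B w y / θ| ≤ 1 := by
        rw [abs_div, abs_of_nonneg hθ]
        exact div_le_one_of_le₀ hw hθ
      have key := two_point_exp_le hx (B y u)
      have hE := mul_le_mul_of_nonneg_left key (Real.exp_pos (B w u + e)).le
      have e1 : B w y / (2 * θ) = B w y / θ / 2 := by rw [div_div, mul_comm]
      specialize h w hw
      rw [e1] at h ⊢
      simp only [expSum, List.map_cons, List.sum_cons, map_add, map_sub, LinearMap.add_apply,
        LinearMap.sub_apply, map_smul, smul_eq_mul] at h ⊢
      have e2 : Real.exp (B w u + B y u + e) = Real.exp (B w u + e) * Real.exp (B y u) := by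
        rw [← Real.exp_add]; ring_nf
      have e3 : Real.exp (B w u - B y u + e) = Real.exp (B w u + e) * Real.exp (-B y u) := by
        rw [← Real.exp_add]; ring_nf
      have e4 : Real.exp (B w u - B y u / θ * B w y + (e + B y u ^ 2 / 2))
          = Real.exp (B w u + e) * Real.exp (-(B w y / θ * B y u) + B y u ^ 2 / 2) := by
        rw [← Real.exp_add]; ring_nf
      rw [e2, e3, e4]
      linarith

end ExpSum

/-! ### The positive semidefinite form attached to the softmax kernel -/

section Kernel

variable {d s : ℕ}

/-- The bilinear form on formal combinations of pairs with
`⟨(k, v), (q, e)⟩ = exp(⟨k, q⟩ / √d) ⟨v, e⟩`. -/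
def kvForm (d s : ℕ) : (KV d s →₀ ℝ) →ₗ[ℝ] (KV d s →₀ ℝ) →ₗ[ℝ] ℝ :=
  Finsupp.linearCombination ℝ fun x => Finsupp.linearCombination ℝ fun y =>
    softmaxKernel x.1 y.1 * inner ℝ x.2 y.2

theorem softmaxKernel_comm (k q : EuclideanSpace ℝ (Fin d)) :
    softmaxKernel k q = softmaxKernel q k := by
  rw [softmaxKernel, softmaxKernel, real_inner_comm]

theorem kvForm_single (x y : KV d s) (a b : ℝ) :
    kvForm d s (Finsupp.single x a) (Finsupp.single y b)
      = a * b * (softmaxKernel x.1 y.1 * inner ℝ x.2 y.2) := by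
  simp [kvForm, Finsupp.linearCombination_single, mul_assoc]

theorem kvForm_apply (w u : KV d s →₀ ℝ) :
    kvForm d s w u
      = ∑ x ∈ w.support, ∑ y ∈ u.support,
          w x * u y * (softmaxKernel x.1 y.1 * inner ℝ x.2 y.2) := by
  simp only [kvForm, Finsupp.linearCombination_apply, Finsupp.sum, LinearMap.sum_apply,
    LinearMap.smul_apply, smul_eq_mul, Finset.mul_sum, mul_assoc]

theorem kvForm_symm (w u : KV d s →₀ ℝ) : kvForm d s w u = kvForm d s u w := by
  rw [kvForm_apply, kvForm_apply, Finset.sum_comm]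
  refine Finset.sum_congr rfl fun x _ => Finset.sum_congr rfl fun y _ => ?_
  rw [softmaxKernel_comm, real_inner_comm, mul_comm (w y)]

/-- The m-th power of an inner product is the inner product of m-fold tensor powers. The form is
therefore a Gram form, a sum of squares over multi-indices and value coordinates. -/
theorem sum_mul_inner_pow_nonneg (S : Finset (KV d s)) (w : KV d s → ℝ) (m : ℕ) :
    0 ≤ ∑ x ∈ S, ∑ y ∈ S, w x * w y * ((inner ℝ x.1 y.1) ^ m * inner ℝ x.2 y.2) := by
  have h (x y : KV d s) : w x * w y * ((inner ℝ x.1 y.1) ^ m * inner ℝ x.2 y.2)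
      = ∑ f : Fin m → Fin d, ∑ l : Fin s,
        (w x * (∏ i, x.1 (f i)) * x.2 l) * (w y * (∏ i, y.1 (f i)) * y.2 l) := by
    have h1 : (inner ℝ x.1 y.1) ^ m = ∑ f : Fin m → Fin d, ∏ i, (x.1 (f i) * y.1 (f i)) := by
      rw [PiLp.inner_apply, Fintype.sum_pow]
      simp [mul_comm]
    rw [h1, PiLp.inner_apply, Finset.sum_mul_sum, Finset.mul_sum]
    refine Finset.sum_congr rfl fun f _ => ?_
    rw [Finset.mul_sum]
    refine Finset.sum_congr rfl fun l _ => ?_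
    rw [Finset.prod_mul_distrib]
    simp
    ring
  have h2 : ∑ x ∈ S, ∑ y ∈ S, w x * w y * ((inner ℝ x.1 y.1) ^ m * inner ℝ x.2 y.2)
      = ∑ f : Fin m → Fin d, ∑ l : Fin s, (∑ x ∈ S, w x * (∏ i, x.1 (f i)) * x.2 l) ^ 2 := by
    simp only [h, sq, Finset.sum_mul_sum]
    calc _ = ∑ x ∈ S, ∑ f : Fin m → Fin d, ∑ y ∈ S, ∑ l : Fin s, _ :=
          Finset.sum_congr rfl fun x _ => Finset.sum_comm
      _ = ∑ f : Fin m → Fin d, ∑ x ∈ S, ∑ y ∈ S, ∑ l : Fin s, _ := Finset.sum_comm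
      _ = ∑ f : Fin m → Fin d, ∑ x ∈ S, ∑ l : Fin s, ∑ y ∈ S, _ :=
          Finset.sum_congr rfl fun f _ => Finset.sum_congr rfl fun x _ => Finset.sum_comm
      _ = _ := Finset.sum_congr rfl fun f _ => Finset.sum_comm
  rw [h2]
  positivity

/-- The Taylor series of exp has nonnegative coefficients, and each of its terms gives a positive
semidefinite form. -/
theorem kvForm_self_nonneg (w : KV d s →₀ ℝ) : 0 ≤ kvForm d s w w := by
  have hs (x y : KV d s) : HasSum (fun m : ℕ => ((Real.sqrt d) ^ m * m.factorial)⁻¹ *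
      (w x * w y * ((inner ℝ x.1 y.1) ^ m * inner ℝ x.2 y.2)))
      (w x * w y * (softmaxKernel x.1 y.1 * inner ℝ x.2 y.2)) := by
    have h1 := NormedSpace.expSeries_div_hasSum_exp (𝔸 := ℝ) (inner ℝ x.1 y.1 / Real.sqrt d)
    rw [← Real.exp_eq_exp_ℝ] at h1
    have h2 := (h1.mul_right (inner ℝ x.2 y.2)).mul_left (w x * w y)
    have e (m : ℕ) : w x * w y * ((inner ℝ x.1 y.1 / Real.sqrt d) ^ m / m.factorial
        * inner ℝ x.2 y.2) = ((Real.sqrt d) ^ m * m.factorial)⁻¹ *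
        (w x * w y * ((inner ℝ x.1 y.1) ^ m * inner ℝ x.2 y.2)) := by
      rw [div_pow, div_div, div_eq_mul_inv]
      ring
    simp only [e] at h2
    exact h2
  rw [kvForm_apply]
  have h := hasSum_sum (s := w.support) fun x _ =>
    hasSum_sum (s := w.support) fun y _ => hs x y
  refine h.nonneg fun m => ?_
  simp only [← Finset.mul_sum]
  exact mul_nonneg (by positivity) (sum_mul_inner_pow_nonneg _ _ _)

end Kernel

end KVCache

/-! ### Values and costs of the metered primitives -/

namespace RealRAM

/-- The meter after `c` further units of time. -/
def Meter.addTime (m : Meter) (c : ℕ) : Meter := ⟨m.time + c, m.live, m.peak⟩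

@[simp] theorem Meter.addTime_zero (m : Meter) : m.addTime 0 = m := rfl

@[simp] theorem Meter.addTime_addTime (m : Meter) (a b : ℕ) :
    (m.addTime a).addTime b = m.addTime (a + b) := by
  simp [Meter.addTime, Nat.add_assoc]

@[simp] theorem Meter.addTime_time (m : Meter) (a : ℕ) : (m.addTime a).time = m.time + a := rfl

@[simp] theorem Meter.addTime_live (m : Meter) (a : ℕ) : (m.addTime a).live = m.live := rfl

@[simp] theorem Meter.addTime_peak (m : Meter) (a : ℕ) : (m.addTime a).peak = m.peak := rfl

theorem Comp.bind_apply {α β : Type} (c : Comp α) (f : α → Comp β) (m : Meter) :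
    (c >>= f) m = (c m).bind fun y => f y.1 y.2 := rfl

theorem Comp.pure_apply {α : Type} (a : α) (m : Meter) : (pure a : Comp α) m = PMF.pure (a, m) :=
  rfl

theorem tick_apply (c : ℕ) (m : Meter) : tick c m = PMF.pure ((), m.addTime c) := rfl

theorem alloc_apply (w : ℕ) (m : Meter) :
    alloc w m = PMF.pure ((), ⟨m.time + w, m.live + w, max m.peak (m.live + w)⟩) := rfl

theorem free_apply (w : ℕ) (m : Meter) :
    free w m = PMF.pure ((), ⟨m.time + w, m.live - w, m.peak⟩) := rfl

theorem add_apply (x y : ℝ) (m : Meter) : add x y m = PMF.pure (x + y, m.addTime 1) := by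
  simp [add, Comp.bind_apply, tick_apply, Comp.pure_apply]

theorem sub_apply (x y : ℝ) (m : Meter) : sub x y m = PMF.pure (x - y, m.addTime 1) := by
  simp [sub, Comp.bind_apply, tick_apply, Comp.pure_apply]

theorem mul_apply (x y : ℝ) (m : Meter) : mul x y m = PMF.pure (x * y, m.addTime 1) := by
  simp [mul, Comp.bind_apply, tick_apply, Comp.pure_apply]

theorem div_apply (x y : ℝ) (m : Meter) : div x y m = PMF.pure (x / y, m.addTime 1) := by
  simp [div, Comp.bind_apply, tick_apply, Comp.pure_apply]

theorem exp_apply (x : ℝ) (m : Meter) : exp x m = PMF.pure (Real.exp x, m.addTime 1) := by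
  simp [exp, Comp.bind_apply, tick_apply, Comp.pure_apply]

theorem log_apply (x : ℝ) (m : Meter) : log x m = PMF.pure (Real.log x, m.addTime 1) := by
  simp [log, Comp.bind_apply, tick_apply, Comp.pure_apply]

theorem sqrt_apply (x : ℝ) (m : Meter) : sqrt x m = PMF.pure (Real.sqrt x, m.addTime 1) := by
  simp [sqrt, Comp.bind_apply, tick_apply, Comp.pure_apply]

theorem abs_apply (x : ℝ) (m : Meter) : abs x m = PMF.pure (|x|, m.addTime 1) := by
  simp [abs, Comp.bind_apply, tick_apply, Comp.pure_apply]

theorem maximum_apply (x y : ℝ) (m : Meter) :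
    maximum x y m = PMF.pure (max x y, m.addTime 1) := by
  simp [maximum, Comp.bind_apply, tick_apply, Comp.pure_apply]

open Classical in
theorem less_apply (x y : ℝ) (m : Meter) :
    less x y m = PMF.pure (decide (x < y), m.addTime 1) := by
  simp [less, Comp.bind_apply, tick_apply, Comp.pure_apply]

theorem flip_apply (p : ℝ) (m : Meter) :
    flip p m = (coin p).map fun b => (b, m.addTime 1) := by
  simp [flip, Comp.bind_apply, tick_apply]

theorem coin_true {p : ℝ} (h0 : 0 ≤ p) (h1 : p ≤ 1) : coin p true = ENNReal.ofReal p := by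
  simp [coin, PMF.ofFintype_apply, h0, h1]

theorem coin_false {p : ℝ} (h0 : 0 ≤ p) (h1 : p ≤ 1) :
    coin p false = ENNReal.ofReal (1 - p) := by
  simp [coin, PMF.ofFintype_apply, h0, h1]

/-- A loop whose body is deterministic and has constant cost is an ordinary fold with a linear time
charge; inner products, correlations and value radii all have this shape. -/
theorem foldlM_apply {α β : Type} {f : β → α → Comp β} {g : β → α → β} {c : ℕ}
    (h : ∀ b a m, f b a m = PMF.pure (g b a, m.addTime c)) (l : List α) (b : β) (m : Meter) :
    l.foldlM f b m = PMF.pure (l.foldl g b, m.addTime (l.length * c)) := by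
  induction l generalizing b m with
  | nil => simp [Comp.pure_apply]
  | cons a l ih =>
    rw [List.foldlM_cons, Comp.bind_apply, h, PMF.pure_bind, ih]
    simp [Nat.add_mul, Nat.add_comm]

theorem foldl_add_eq_sum {α : Type} (g : α → ℝ) (l : List α) (b : ℝ) :
    l.foldl (fun acc a => acc + g a) b = b + (l.map g).sum := by
  induction l generalizing b with
  | nil => simp
  | cons a l ih => simp [ih, add_assoc]

theorem dot_apply {k : ℕ} (x y : EuclideanSpace ℝ (Fin k)) (m : Meter) :
    dot x y m = PMF.pure (inner ℝ x y, m.addTime (2 * k)) := by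
  have h := foldlM_apply (f := fun acc i => do
    let a ← mul (x i) (y i)
    add acc a) (g := fun acc i => acc + x i * y i) (c := 2)
    (fun b a m => by simp [Comp.bind_apply, mul_apply, add_apply]) (List.finRange k) 0 m
  rw [dot, h, foldl_add_eq_sum, ← Fin.sum_univ_def, PiLp.inner_apply]
  simp [mul_comm]

end RealRAM

/-! ### The signed walk and the law of SoftmaxBalance -/

namespace KVCache

open RealRAM (Meter Comp)

variable {d s : ℕ}

/-- The signed sum of the pairs in a signed list, as a formal combination. -/
def walk (signed : List (KV d s × Bool)) : KV d s →₀ ℝ :=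
  (signed.map fun y => Finsupp.single y.1 (signValue y.2)).sum

theorem walk_append_singleton (signed : List (KV d s × Bool)) (x : KV d s) (b : Bool) :
    walk (signed ++ [(x, b)]) = walk signed + Finsupp.single x (signValue b) := by
  simp [walk]

theorem kvForm_walk (signed : List (KV d s × Bool)) (x : KV d s) :
    kvForm d s (walk signed) (Finsupp.single x 1)
      = (signed.map fun y =>
          softmaxKernel y.1.1 x.1 * inner ℝ y.1.2 x.2 * signValue y.2).sum := by
  induction signed with
  | nil => simp [walk]
  | cons y l ih =>
    simp only [walk, List.map_cons, List.sum_cons, map_add, LinearMap.add_apply] at ih ⊢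
    rw [ih, kvForm_single]
    ring

theorem correlation_apply (signed : List (KV d s × Bool)) (x : KV d s) (m : Meter) :
    correlation (Real.sqrt d) signed x m
      = PMF.pure (kvForm d s (walk signed) (Finsupp.single x 1),
          m.addTime (signed.length * (2 * d + 2 * s + 5))) := by
  rw [correlation, RealRAM.foldlM_apply
    (g := fun acc y => acc + softmaxKernel y.1.1 x.1 * inner ℝ y.1.2 x.2 * signValue y.2)
    (c := 2 * d + 2 * s + 5), RealRAM.foldl_add_eq_sum, kvForm_walk, zero_add]
  intro b y m
  simp only [RealRAM.Comp.bind_apply, RealRAM.dot_apply, RealRAM.div_apply, RealRAM.exp_apply,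
    RealRAM.mul_apply, RealRAM.add_apply, PMF.pure_bind, Meter.addTime_addTime, softmaxKernel]
  congr 3
  ring

theorem assignSigns_cons_apply (thr : ℝ) (x : KV d s) (xs : List (KV d s))
    (signed : List (KV d s × Bool)) (m : Meter) :
    assignSigns (Real.sqrt d) thr (x :: xs) signed m =
      if thr < |kvForm d s (walk signed) (Finsupp.single x 1)| then
        PMF.pure (none, m.addTime (signed.length * (2 * d + 2 * s + 5) + 2))
      else (RealRAM.coin (1 / 2 - kvForm d s (walk signed) (Finsupp.single x 1) / (2 * thr))).bind
        fun b => assignSigns (Real.sqrt d) thr xs (signed ++ [(x, b)])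
          (m.addTime (signed.length * (2 * d + 2 * s + 5) + 6)) := by
  rw [assignSigns]
  simp only [RealRAM.Comp.bind_apply, correlation_apply, RealRAM.abs_apply, RealRAM.less_apply,
    PMF.pure_bind, Meter.addTime_addTime, decide_eq_true_eq]
  split_ifs
  · rfl
  · simp only [RealRAM.Comp.bind_apply, RealRAM.mul_apply, RealRAM.div_apply, RealRAM.sub_apply,
      RealRAM.flip_apply, PMF.pure_bind, PMF.bind_map, Meter.addTime_addTime, Nat.add_assoc]
    rfl

/-- The time bound charges each correlation as if all pairs were already signed, which is what makes
it quadratic. -/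
theorem assignSigns_support (thr : ℝ) (xs : List (KV d s)) (signed : List (KV d s × Bool))
    (m : Meter) :
    ∀ y ∈ (assignSigns (Real.sqrt d) thr xs signed m).support,
      y.2.live = m.live ∧ y.2.peak = m.peak ∧
      y.2.time ≤ m.time
        + xs.length * ((signed.length + xs.length) * (2 * d + 2 * s + 5) + 6) ∧
      ∀ sg, y.1 = some sg → sg.map Prod.fst = signed.map Prod.fst ++ xs := by
  induction xs generalizing signed m with
  | nil =>
    intro y hy
    rw [assignSigns, RealRAM.Comp.pure_apply, PMF.mem_support_pure_iff] at hy
    subst hy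
    simp
  | cons x xs ih =>
    intro y hy
    rw [assignSigns_cons_apply] at hy
    split_ifs at hy
    · rw [PMF.mem_support_pure_iff] at hy
      subst hy
      refine ⟨rfl, rfl, ?_, by simp⟩
      simp only [Meter.addTime_time, List.length_cons]
      nlinarith [Nat.zero_le (xs.length * ((signed.length + (xs.length + 1))
        * (2 * d + 2 * s + 5) + 6)), Nat.zero_le ((xs.length + 1) * (2 * d + 2 * s + 5))]
    · rw [PMF.mem_support_bind_iff] at hy
      obtain ⟨b, -, hy⟩ := hy
      obtain ⟨h1, h2, h3, h4⟩ := ih _ _ y hy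
      refine ⟨h1, h2, h3.trans ?_, fun sg hsg => ?_⟩
      · simp only [Meter.addTime_time, List.length_append, List.length_cons, List.length_nil]
        have : signed.length * (2 * d + 2 * s + 5) ≤
          (signed.length + (xs.length + 1)) * (2 * d + 2 * s + 5) :=
            Nat.mul_le_mul_right _ (Nat.le_add_right _ _)
        have e : signed.length + (0 + 1) + xs.length = signed.length + (xs.length + 1) := by omega
        rw [e, Nat.add_mul xs.length 1, Nat.one_mul]
        omega
      · rw [h4 sg hsg]
        simp

theorem valueRadius_apply (B : List (KV d s)) (m : Meter) :
    valueRadius B m = PMF.pure (B.foldl (fun acc x => max acc ‖x.2‖) 0,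
      m.addTime (B.length * (2 * s + 2))) := by
  rw [valueRadius, RealRAM.foldlM_apply (g := fun acc x => max acc ‖x.2‖) (c := 2 * s + 2)]
  intro b y m
  simp only [RealRAM.Comp.bind_apply, RealRAM.dot_apply, RealRAM.sqrt_apply,
    RealRAM.maximum_apply, PMF.pure_bind, Meter.addTime_addTime]
  rw [norm_eq_sqrt_real_inner (F := EuclideanSpace ℝ (Fin s))]

/-- The maximal norm of a value vector in a list. -/
def maxValueNorm (B : List (KV d s)) : ℝ := B.foldl (fun acc x => max acc ‖x.2‖) 0

/-- The radius `R = exp(r² / (2√d)) ‖·‖_max` of SoftmaxBalance. -/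
def balanceRadius (d : ℕ) (r rval : ℝ) : ℝ := Real.exp (r * r / (2 * Real.sqrt d)) * rval

/-- The failure threshold of SoftmaxBalance. -/
def balanceThreshold (n d : ℕ) (r rval δ : ℝ) : ℝ :=
  30 * Real.log (n / δ) * (balanceRadius d r rval * balanceRadius d r rval)

theorem softmaxBalance_apply (n : ℕ) (r rval δ : ℝ) (B : List (KV d s)) (m : Meter) :
    softmaxBalance n r rval δ B m =
      (assignSigns (Real.sqrt d) (balanceThreshold n d r rval δ) B []
        ⟨m.time + (B.length + 16) + 11, m.live + (B.length + 16),
          max m.peak (m.live + (B.length + 16))⟩).bind fun y =>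
        match y.1 with
        | none => PMF.pure (none, ⟨y.2.time + (B.length + 16), y.2.live - (B.length + 16),
            y.2.peak⟩)
        | some sg => PMF.pure (some (smallerClass sg),
            ⟨y.2.time + 2 * sg.length + (d + s) * (smallerClass sg).length + (B.length + 16),
              y.2.live + (d + s) * (smallerClass sg).length - (B.length + 16),
              max y.2.peak (y.2.live + (d + s) * (smallerClass sg).length)⟩) := by
  rw [softmaxBalance]
  simp only [RealRAM.Comp.bind_apply, RealRAM.alloc_apply, RealRAM.sqrt_apply, RealRAM.mul_apply,
    RealRAM.div_apply, RealRAM.exp_apply, RealRAM.log_apply, PMF.pure_bind,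
    Meter.addTime_addTime]
  congr 1
  funext y
  rcases y with ⟨_ | sg, m'⟩
  · simp [RealRAM.Comp.bind_apply, RealRAM.free_apply, RealRAM.Comp.pure_apply]
  · simp only [RealRAM.Comp.bind_apply, RealRAM.free_apply, RealRAM.Comp.pure_apply,
      RealRAM.tick_apply, RealRAM.alloc_apply, PMF.pure_bind, Meter.addTime]

end KVCache

/-! ### Union bounds for discrete laws -/

theorem PMF.toOuterMeasure_le_one {α : Type*} (μ : PMF α) (S : Set α) :
    μ.toOuterMeasure S ≤ 1 := by
  rw [PMF.toOuterMeasure_apply, ← μ.tsum_coe]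
  exact ENNReal.tsum_le_tsum fun x => Set.indicator_le_self _ _ x

/-- Either the first stage lands in `T`, or the second stage goes wrong from a good point.
Restricting to the support lets the second estimate use invariants valid for all outcomes. -/
theorem PMF.toOuterMeasure_bind_le {α β : Type*} {μ : PMF α} {f : α → PMF β} {S : Set β}
    {T : Set α} {p q : ℝ≥0∞} (hT : μ.toOuterMeasure T ≤ p)
    (hf : ∀ x ∈ μ.support, x ∉ T → (f x).toOuterMeasure S ≤ q) :
    (μ.bind f).toOuterMeasure S ≤ p + q := by
  rw [PMF.toOuterMeasure_bind_apply]
  calc ∑' a, μ a * (f a).toOuterMeasure S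
      ≤ ∑' a, (T.indicator μ a + μ a * q) := by
        refine ENNReal.tsum_le_tsum fun a => ?_
        by_cases ha : a ∈ T
        · rw [Set.indicator_of_mem ha]
          exact (mul_le_of_le_one_right' (PMF.toOuterMeasure_le_one _ _)).trans le_self_add
        · rw [Set.indicator_of_notMem ha, zero_add]
          by_cases h0 : μ a = 0
          · simp [h0]
          · gcongr
            exact hf a ((μ.mem_support_iff a).2 h0) ha
    _ = μ.toOuterMeasure T + 1 * q := by
        rw [ENNReal.tsum_add, ENNReal.tsum_mul_right, μ.tsum_coe, PMF.toOuterMeasure_apply]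
    _ ≤ p + q := by rw [one_mul]; gcongr

theorem PMF.toOuterMeasure_pure_eq_zero {α : Type*} {a : α} {S : Set α} (h : a ∉ S) :
    (PMF.pure a).toOuterMeasure S = 0 := by
  rw [PMF.toOuterMeasure_pure_apply, if_neg h]

namespace KVCache

open RealRAM (Meter Comp)

variable {d s : ℕ}

/-! ### Failure probability of SoftmaxBalance -/

/-- Backward induction over the unsigned pairs. The list `L` depends only on those pairs, so a
single potential works for every position of the walk. The event contains FAIL, since the condition
is vacuous for `none`. -/
theorem exists_expSum_assignSigns {c ρ : ℝ} (hc : 1 ≤ c) (hρ : 0 ≤ ρ)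
    (Bad : List (KV d s × Bool) → Prop) (L₀ : List ((KV d s →₀ ℝ) × ℝ))
    (hL₀ : ∀ sg, Bad sg → 1 ≤ expSum (kvForm d s) L₀ (walk sg)) (xs : List (KV d s))
    (hxs : ∀ x ∈ xs, kvForm d s (Finsupp.single x 1) (Finsupp.single x 1) ≤ ρ) :
    ∃ L, expMass (kvForm d s) (c * ρ) L
        ≤ expMass (kvForm d s) (c * ρ) L₀ + xs.length * (2 * Real.exp (-(c / 2))) ∧
      ∀ signed m, (assignSigns (Real.sqrt d) (c * ρ) xs signed m).toOuterMeasure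
        {y | ∀ sg, y.1 = some sg → Bad sg}
          ≤ ENNReal.ofReal (expSum (kvForm d s) L (walk signed)) := by
  induction xs with
  | nil =>
    refine ⟨L₀, by simp, fun signed m => ?_⟩
    rw [assignSigns, RealRAM.Comp.pure_apply]
    by_cases h : Bad signed
    · refine (PMF.toOuterMeasure_le_one _ _).trans ?_
      exact ENNReal.one_le_ofReal.2 (hL₀ _ h)
    · rw [PMF.toOuterMeasure_pure_eq_zero]
      · exact zero_le
      · simpa using h
  | cons x xs ih =>
    obtain ⟨L₁, hL₁, h₁⟩ := ih fun y hy => hxs y (List.mem_cons_of_mem _ hy)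
    have hx := hxs x List.mem_cons_self
    set e : KV d s →₀ ℝ := Finsupp.single x 1 with he
    have hθ : 0 ≤ c * ρ := mul_nonneg (by linarith) hρ
    obtain ⟨L₂, hL₂, h₂⟩ := exists_expSum_step hθ kvForm_self_nonneg kvForm_symm e
      (hx.trans (le_mul_of_one_le_left hρ hc)) L₁
    -- The two new exponentials sum to at least 1 when |B(w,e)| > cρ > 0. With scale 1/ρ and ‖e‖² ≤
    -- ρ, each has mass at most exp(-c + c/2).
    refine ⟨[(ρ⁻¹ • e, -c), (-ρ⁻¹ • e, -c)] ++ L₂, ?_, fun signed m => ?_⟩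
    · rw [expMass_append]
      have hF : -c + c * ρ / 2 * (ρ⁻¹ * (ρ⁻¹ * kvForm d s e e)) ≤ -(c / 2) := by
        rcases hρ.eq_or_lt with h0 | h0
        · subst h0
          simp
          linarith
        · have : c * ρ / 2 * (ρ⁻¹ * (ρ⁻¹ * kvForm d s e e)) ≤ c * ρ / 2 * (ρ⁻¹ * (ρ⁻¹ * ρ)) := by
            gcongr
          have e2 : c * ρ / 2 * (ρ⁻¹ * (ρ⁻¹ * ρ)) = c / 2 := by field_simp
          linarith
      have hF' := Real.exp_le_exp.2 hF
      have : expMass (kvForm d s) (c * ρ) [(ρ⁻¹ • e, -c), (-ρ⁻¹ • e, -c)]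
          ≤ 2 * Real.exp (-(c / 2)) := by
        simp only [expMass, List.map_cons, List.map_nil, List.sum_cons, List.sum_nil, map_smul,
          LinearMap.smul_apply, smul_eq_mul, neg_mul, mul_neg, neg_neg]
        linarith
      push_cast [List.length_cons]
      linarith
    · rw [expSum_append, assignSigns_cons_apply]
      set z := kvForm d s (walk signed) e with hz
      split_ifs with h
      · refine (PMF.toOuterMeasure_le_one _ _).trans (ENNReal.one_le_ofReal.2 ?_)
        -- If ρ = 0, Cauchy–Schwarz gives z = 0, which does not exceed the threshold 0; FAIL is then
        -- impossible.
        have h0 : 0 < ρ := by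
          refine lt_of_le_of_ne hρ fun h0 => ?_
          have hCS := LinearMap.BilinForm.apply_mul_apply_le_of_forall_zero_le _ kvForm_self_nonneg
            (walk signed) e
          have hee : kvForm d s e e = 0 := le_antisymm (h0 ▸ hx) (kvForm_self_nonneg _)
          rw [hee, mul_zero, kvForm_symm e, ← hz, ← sq] at hCS
          have hz0 : z = 0 := by nlinarith
          rw [hz0, ← h0] at h
          simp at h
        have h3 : 1 ≤ expSum (kvForm d s) [(ρ⁻¹ • e, -c), (-ρ⁻¹ • e, -c)] (walk signed) := by
          simp only [expSum, List.map_cons, List.map_nil, List.sum_cons, List.sum_nil, map_smul,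
            smul_eq_mul, neg_mul, ← hz]
          have hp1 := Real.exp_pos (ρ⁻¹ * z + -c)
          have hp2 := Real.exp_pos (-(ρ⁻¹ * z) + -c)
          rcases lt_abs.1 h with h | h
          · have h4 : c ≤ ρ⁻¹ * z := by rw [← div_eq_inv_mul, le_div_iff₀ h0]; exact h.le
            have := Real.one_le_exp (x := ρ⁻¹ * z + -c) (by linarith)
            linarith
          · have h4 : c ≤ ρ⁻¹ * (-z) := by rw [← div_eq_inv_mul, le_div_iff₀ h0]; exact h.le
            have := Real.one_le_exp (x := -(ρ⁻¹ * z) + -c) (by linarith)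
            linarith
        have := expSum_nonneg (kvForm d s) L₂ (walk signed)
        linarith
      · rw [not_lt] at h
        -- The coin parameter lies in [0, 1], so the clamp is inactive. A zero threshold makes the
        -- quotient 0, a fair coin.
        have hx1 : |z / (2 * (c * ρ))| ≤ 1 / 2 := by
          rw [abs_div, abs_of_nonneg (mul_nonneg zero_le_two hθ)]
          rcases hθ.eq_or_lt with h0 | h0
          · rw [← h0]; simp
          · rw [div_le_iff₀ (by positivity)]
            linarith
        obtain ⟨hl, hr⟩ := abs_le.1 hx1
        have h3 := h₂ (walk signed) h
        rw [← hz] at h3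
        rw [PMF.toOuterMeasure_bind_apply, tsum_bool,
          RealRAM.coin_true (by linarith) (by linarith),
          RealRAM.coin_false (by linarith) (by linarith)]
        have ht := h₁ (signed ++ [(x, true)])
          (m.addTime (signed.length * (2 * d + 2 * s + 5) + 6))
        have hf := h₁ (signed ++ [(x, false)])
          (m.addTime (signed.length * (2 * d + 2 * s + 5) + 6))
        rw [walk_append_singleton] at ht hf
        have e1 : Finsupp.single x (signValue true) = e := by simp [signValue, he]
        have e2 : Finsupp.single x (signValue false) = -e := by
          simp [signValue, he, Finsupp.single_neg]
        rw [e1] at ht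
        rw [e2, ← sub_eq_add_neg] at hf
        refine (add_le_add (mul_le_mul_right hf _) (mul_le_mul_right ht _)).trans ?_
        rw [← ENNReal.ofReal_mul (by linarith), ← ENNReal.ofReal_mul (by linarith),
          ← ENNReal.ofReal_add (mul_nonneg (by linarith) (expSum_nonneg _ _ _))
            (mul_nonneg (by linarith) (expSum_nonneg _ _ _))]
        refine ENNReal.ofReal_le_ofReal ?_
        have := expSum_nonneg (kvForm d s) [(ρ⁻¹ • e, -c), (-ρ⁻¹ • e, -c)] (walk signed)
        have e3 : 1 - (1 / 2 - z / (2 * (c * ρ))) = 1 / 2 + z / (2 * (c * ρ)) := by ring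
        rw [e3]
        linarith

/-- The unnormalized attention output `∑ exp(⟨k, q⟩ / √d) v` of a list of pairs. -/
def kernelSum (q : EuclideanSpace ℝ (Fin d)) (B : List (KV d s)) : EuclideanSpace ℝ (Fin s) :=
  (B.map fun x => softmaxKernel x.1 q • x.2).sum

/-- The signed sum `∑ η exp(⟨k, q⟩ / √d) v`. -/
def signedSum (q : EuclideanSpace ℝ (Fin d)) (sg : List (KV d s × Bool)) :
    EuclideanSpace ℝ (Fin s) :=
  (sg.map fun y => signValue y.2 • softmaxKernel y.1.1 q • y.1.2).sum

theorem kvForm_walk_basis (q : EuclideanSpace ℝ (Fin d)) (sg : List (KV d s × Bool)) (l : Fin s) :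
    kvForm d s (walk sg) (Finsupp.single (q, EuclideanSpace.single l 1) 1)
      = signedSum q sg l := by
  rw [kvForm_walk, signedSum]
  induction sg with
  | nil => simp
  | cons y sg ih =>
    simp only [List.map_cons, List.sum_cons, ih, PiLp.add_apply, PiLp.smul_apply, smul_eq_mul]
    simp only [EuclideanSpace.inner_single_right, one_mul]
    simp
    ring

theorem expSum_flatMap {W ι : Type*} [AddCommGroup W] [Module ℝ W] (B : W →ₗ[ℝ] W →ₗ[ℝ] ℝ)
    (l : List ι) (f : ι → List (W × ℝ)) (w : W) :
    expSum B (l.flatMap f) w = (l.map fun a => expSum B (f a) w).sum := by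
  induction l with
  | nil => simp [expSum]
  | cons a l ih => rw [List.flatMap_cons, expSum_append, ih, List.map_cons, List.sum_cons]

theorem expMass_flatMap {W ι : Type*} [AddCommGroup W] [Module ℝ W] (B : W →ₗ[ℝ] W →ₗ[ℝ] ℝ)
    (θ : ℝ) (l : List ι) (f : ι → List (W × ℝ)) :
    expMass B θ (l.flatMap f) = (l.map fun a => expMass B θ (f a)).sum := by
  induction l with
  | nil => simp [expMass]
  | cons a l ih => rw [List.flatMap_cons, expMass_append, ih, List.map_cons, List.sum_cons]

/-- The exponentials that detect a large signed sum at one of the points `q j`. -/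
def detector {N : ℕ} (s : ℕ) (c lam : ℝ) (q : Fin N → EuclideanSpace ℝ (Fin d)) :
    List ((KV d s →₀ ℝ) × ℝ) :=
  (List.finRange N).flatMap fun j => (List.finRange s).flatMap fun l =>
    [(Finsupp.single (q j, EuclideanSpace.single l 1) lam, -c - Real.log s),
      (Finsupp.single (q j, EuclideanSpace.single l 1) (-lam), -c - Real.log s)]

theorem expSum_detector {N : ℕ} (hs : 0 < s) (c lam : ℝ) (q : Fin N → EuclideanSpace ℝ (Fin d))
    (sg : List (KV d s × Bool)) :
    expSum (kvForm d s) (detector s c lam q) (walk sg)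
      = ∑ j, Real.exp (-c) * (2 * ((∑ l, Real.cosh (lam * signedSum (q j) sg l)) / s)) := by
  have hs' : (0 : ℝ) < s := by exact_mod_cast hs
  have h (j : Fin N) (l : Fin s) (a : ℝ) :
      kvForm d s (walk sg) (Finsupp.single (q j, EuclideanSpace.single l 1) a)
        = a * signedSum (q j) sg l := by
    rw [← kvForm_walk_basis, ← smul_eq_mul, ← map_smul, Finsupp.smul_single, smul_eq_mul, mul_one]
  rw [detector, expSum_flatMap, ← Fin.sum_univ_def]
  refine Finset.sum_congr rfl fun j _ => ?_
  rw [expSum_flatMap, ← Fin.sum_univ_def, Finset.sum_div, Finset.mul_sum, Finset.mul_sum]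
  refine Finset.sum_congr rfl fun l _ => ?_
  simp only [expSum, List.map_cons, List.map_nil, List.sum_cons, List.sum_nil, h]
  have he : Real.exp (-c - Real.log s) = Real.exp (-c) / s := by
    rw [Real.exp_sub, Real.exp_log hs']
  rw [Real.cosh_eq, Real.exp_add, Real.exp_add, he, neg_mul]
  field_simp
  ring

/-- By convexity, the average of cosh over the coordinates is at least cosh(‖signed sum‖/(√s·G)) ≥
cosh c, and 2·cosh c cancels the prefactor exp(-c). -/
theorem one_le_expSum_detector {N : ℕ} (hs : 0 < s) {c G : ℝ} (hc : 0 ≤ c) (hG : 0 < G)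
    (q : Fin N → EuclideanSpace ℝ (Fin d)) (sg : List (KV d s × Bool)) (j : Fin N)
    (h : Real.sqrt s * c * G < ‖signedSum (q j) sg‖) :
    1 ≤ expSum (kvForm d s) (detector s c G⁻¹ q) (walk sg) := by
  have hs' : (0 : ℝ) < s := by exact_mod_cast hs
  have hcosh (x : ℝ) : 0 ≤ Real.cosh x := (Real.cosh_pos x).le
  rw [expSum_detector hs]
  refine le_trans ?_ (Finset.single_le_sum (f := fun j => Real.exp (-c) *
    (2 * ((∑ l, Real.cosh (G⁻¹ * signedSum (q j) sg l)) / s)))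
    (fun i _ => by have := fun l => hcosh (G⁻¹ * signedSum (q i) sg l); positivity)
    (Finset.mem_univ j))
  have h1 : c ≤ Real.sqrt ((∑ l, (G⁻¹ * signedSum (q j) sg l) ^ 2) / s) := by
    have : Real.sqrt ((∑ l, (G⁻¹ * signedSum (q j) sg l) ^ 2) / s)
        = ‖signedSum (q j) sg‖ / (Real.sqrt s * G) := by
      simp only [mul_pow]
      rw [← Finset.mul_sum, Real.sqrt_div' _ hs'.le, Real.sqrt_mul (by positivity),
        Real.sqrt_sq (by positivity), EuclideanSpace.norm_eq]
      simp only [Real.norm_eq_abs, sq_abs]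
      field_simp
    rw [this, le_div_iff₀ (by positivity)]
    linarith
  have h2 := cosh_sqrt_mean_le hs fun l => G⁻¹ * signedSum (q j) sg l
  have h3 : Real.cosh c ≤ Real.cosh (Real.sqrt ((∑ l, (G⁻¹ * signedSum (q j) sg l) ^ 2) / s)) := by
    rw [Real.cosh_le_cosh, abs_of_nonneg hc, abs_of_nonneg (Real.sqrt_nonneg _)]
    exact h1
  calc 1 = Real.exp (-c) * Real.exp c := by rw [← Real.exp_add]; simp
    _ ≤ Real.exp (-c) * (2 * Real.cosh c) := by
      gcongr
      exact exp_le_two_mul_cosh c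
    _ ≤ _ := by
      gcongr
      exact h3.trans h2

/-- The scale 1/√(ρκ) makes the Gaussian correction at most c/2. The offset -log s turns the sum
over coordinates into an average, so s drops out. -/
theorem expMass_detector_le {N : ℕ} (hs : 0 < s) {c ρ κ : ℝ} (hc : 0 ≤ c) (hρ : 0 < ρ)
    (hκ : 0 < κ) (q : Fin N → EuclideanSpace ℝ (Fin d))
    (hq : ∀ j, softmaxKernel (q j) (q j) ≤ κ) :
    expMass (kvForm d s) (c * ρ) (detector s c (Real.sqrt (ρ * κ))⁻¹ q)
      ≤ N * (2 * Real.exp (-(c / 2))) := by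
  have hs' : (0 : ℝ) < s := by exact_mod_cast hs
  have hsq : (Real.sqrt (ρ * κ))⁻¹ * (Real.sqrt (ρ * κ))⁻¹ = (ρ * κ)⁻¹ := by
    rw [← mul_inv, Real.mul_self_sqrt (by positivity)]
  rw [detector, expMass_flatMap, ← Fin.sum_univ_def]
  calc _ ≤ ∑ j : Fin N, 2 * Real.exp (-(c / 2)) := Finset.sum_le_sum fun j _ => ?_
    _ = _ := by simp
  rw [expMass_flatMap, ← Fin.sum_univ_def]
  calc _ ≤ ∑ l : Fin s, 2 * (Real.exp (-(c / 2)) / s) := Finset.sum_le_sum fun l _ => ?_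
    _ = _ := by
      rw [Finset.sum_const, Finset.card_univ, Fintype.card_fin, nsmul_eq_mul]
      field_simp
  simp only [expMass, List.map_cons, List.map_nil, List.sum_cons, List.sum_nil, kvForm_single,
    neg_mul_neg, hsq]
  have h1 : Real.exp (-c - Real.log s + c * ρ / 2 * ((ρ * κ)⁻¹ * (softmaxKernel (q j) (q j) *
      inner ℝ (EuclideanSpace.single l 1 : EuclideanSpace ℝ (Fin s)) (EuclideanSpace.single l 1))))
      ≤ Real.exp (-(c / 2)) / s := by
    have : Real.exp (-(c / 2)) / s = Real.exp (-(c / 2) - Real.log s) := by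
      rw [Real.exp_sub, Real.exp_log hs']
    rw [this, Real.exp_le_exp]
    have h2 : c * ρ / 2 * ((ρ * κ)⁻¹ * softmaxKernel (q j) (q j))
        ≤ c * ρ / 2 * ((ρ * κ)⁻¹ * κ) := by
      gcongr
      exact hq j
    have h3 : c * ρ / 2 * ((ρ * κ)⁻¹ * κ) = c / 2 := by field_simp
    simp only [EuclideanSpace.inner_single_left, map_one, PiLp.single_apply, if_true,
      mul_one]
    linarith
  linarith

/-! ### The output of SoftmaxBalance -/

theorem length_filter_add (sg : List (KV d s × Bool)) :
    (sg.filter fun y => y.2).length + (sg.filter fun y => !y.2).length = sg.length := by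
  induction sg with
  | nil => rfl
  | cons y l ih => rcases y with ⟨x, _ | _⟩ <;> simp <;> omega

theorem smallerClass_sublist (sg : List (KV d s × Bool)) :
    (smallerClass sg).Sublist (sg.map Prod.fst) := by
  simp only [smallerClass]
  split_ifs
  · exact List.filter_sublist.map _
  · exact List.filter_sublist.map _

theorem two_mul_length_smallerClass_le (sg : List (KV d s × Bool)) :
    2 * (smallerClass sg).length ≤ sg.length := by
  have := length_filter_add sg
  simp only [smallerClass]
  split_ifs with h <;> simp only [List.length_map] at * <;> omega

theorem kernelSum_cons (q : EuclideanSpace ℝ (Fin d)) (x : KV d s) (B : List (KV d s)) :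
    kernelSum q (x :: B) = softmaxKernel x.1 q • x.2 + kernelSum q B := by
  simp [kernelSum]

theorem kernelSum_append (q : EuclideanSpace ℝ (Fin d)) (B B' : List (KV d s)) :
    kernelSum q (B ++ B') = kernelSum q B + kernelSum q B' := by
  simp [kernelSum]

@[simp] theorem kernelSum_nil (q : EuclideanSpace ℝ (Fin d)) :
    kernelSum q ([] : List (KV d s)) = 0 := rfl

theorem kernelSum_sub_plus (q : EuclideanSpace ℝ (Fin d)) (sg : List (KV d s × Bool)) :
    kernelSum q (sg.map Prod.fst)
        - (2 : ℝ) • kernelSum q ((sg.filter fun y => y.2).map Prod.fst) = -signedSum q sg := by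
  induction sg with
  | nil => simp [signedSum]
  | cons y l ih =>
    rw [sub_eq_iff_eq_add] at ih
    rcases y with ⟨x, _ | _⟩
    · simp only [signedSum, List.map_cons, kernelSum_cons, List.filter_cons, List.sum_cons, ih]
      simp only [signValue, Bool.false_eq_true, if_false]
      module
    · simp only [signedSum, List.map_cons, kernelSum_cons, List.filter_cons, List.sum_cons, ih,
        if_true]
      simp only [signValue, if_true]
      module

theorem kernelSum_sub_minus (q : EuclideanSpace ℝ (Fin d)) (sg : List (KV d s × Bool)) :
    kernelSum q (sg.map Prod.fst)
        - (2 : ℝ) • kernelSum q ((sg.filter fun y => !y.2).map Prod.fst) = signedSum q sg := by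
  induction sg with
  | nil => simp [signedSum]
  | cons y l ih =>
    rw [sub_eq_iff_eq_add] at ih
    rcases y with ⟨x, _ | _⟩
    · simp only [signedSum, List.map_cons, kernelSum_cons, List.filter_cons, List.sum_cons, ih,
        Bool.not_false, if_true]
      simp only [signValue, Bool.false_eq_true, if_false]
      module
    · simp only [signedSum, List.map_cons, kernelSum_cons, List.filter_cons, List.sum_cons, ih,
        Bool.not_true, Bool.false_eq_true, if_false]
      simp only [signValue, if_true]
      module

/-- Doubling either class leaves plus or minus the signed sum as error, so choosing the smaller
class costs no accuracy. -/
theorem norm_kernelSum_sub_smallerClass (q : EuclideanSpace ℝ (Fin d))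
    (sg : List (KV d s × Bool)) :
    ‖kernelSum q (sg.map Prod.fst) - (2 : ℝ) • kernelSum q (smallerClass sg)‖
      = ‖signedSum q sg‖ := by
  simp only [smallerClass]
  split_ifs
  · rw [kernelSum_sub_plus, norm_neg]
  · rw [kernelSum_sub_minus]

theorem signedSum_eq_zero (q : EuclideanSpace ℝ (Fin d)) (sg : List (KV d s × Bool))
    (h : ∀ x ∈ sg.map Prod.fst, x.2 = 0) : signedSum q sg = 0 := by
  refine List.sum_eq_zero fun y hy => ?_
  obtain ⟨a, ha, rfl⟩ := List.mem_map.1 hy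
  rw [h a.1 (List.mem_map_of_mem ha), smul_zero, smul_zero]

theorem softmaxBalance_support (n : ℕ) (r rval δ : ℝ) (B : List (KV d s)) (m : Meter) :
    ∀ y ∈ (softmaxBalance n r rval δ B m).support,
      y.2.peak ≤ max m.peak (m.live + (B.length + 16) + (d + s) * B.length) ∧
      y.2.time ≤ m.time + (B.length * (B.length * (2 * d + 2 * s + 5) + 6)
        + 4 * B.length + 43 + (d + s) * B.length) ∧
      ∀ out, y.1 = some out → out.Sublist B ∧ 2 * out.length ≤ B.length ∧
        y.2.live = m.live + (d + s) * out.length := by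
  intro y hy
  rw [softmaxBalance_apply, PMF.mem_support_bind_iff] at hy
  obtain ⟨⟨o, m'⟩, ho, hy⟩ := hy
  obtain ⟨h1, h2, h3, h4⟩ := assignSigns_support _ _ _ _ _ ho
  simp only [List.length_nil, zero_add, List.map_nil, List.nil_append] at h1 h2 h3 h4
  rcases o with _ | sg
  · simp only [PMF.mem_support_pure_iff] at hy
    subst hy
    refine ⟨?_, ?_, by simp⟩
    · simp only [h2]
      omega
    · simp only
      omega
  · simp only [PMF.mem_support_pure_iff] at hy
    subst hy
    have hB := h4 sg rfl
    have hlen : sg.length = B.length := by rw [← hB, List.length_map]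
    have h5 := two_mul_length_smallerClass_le sg
    have h6 : (d + s) * (smallerClass sg).length ≤ (d + s) * B.length :=
      Nat.mul_le_mul_left _ (by omega)
    refine ⟨?_, ?_, ?_⟩
    · simp only [h2, h1]
      omega
    · simp only
      omega
    · rintro out hout
      simp only [Option.some.injEq] at hout
      subst hout
      refine ⟨hB ▸ smallerClass_sublist sg, by omega, ?_⟩
      simp only [h1]
      omega

theorem softmaxKernel_self_le {r : ℝ} {q : EuclideanSpace ℝ (Fin d)} (hq : ‖q‖ ≤ r) :
    softmaxKernel q q ≤ Real.exp (r ^ 2 / Real.sqrt d) := by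
  rw [softmaxKernel, real_inner_self_eq_norm_sq]
  gcongr

/-- With overwhelming probability SoftmaxBalance does not fail and halves its input up to a small
error at all the given query points. -/
theorem softmaxBalance_bad_le {N n : ℕ} {r rval δ c : ℝ} (hs : 0 < s) (hrval : 0 ≤ rval)
    (hc : c = 30 * Real.log (n / δ)) (hc1 : 1 ≤ c) (q : Fin N → EuclideanSpace ℝ (Fin d))
    (hq : ∀ j, ‖q j‖ ≤ r) (B : List (KV d s)) (hBk : ∀ x ∈ B, ‖x.1‖ ≤ r)
    (hBv : ∀ x ∈ B, ‖x.2‖ ≤ rval) (m : Meter) :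
    (softmaxBalance n r rval δ B m).toOuterMeasure
      {y | ¬ ∃ out, y.1 = some out ∧ ∀ j, ‖kernelSum (q j) B - (2 : ℝ) • kernelSum (q j) out‖
          ≤ Real.sqrt s * c * (Real.exp (r ^ 2 / Real.sqrt d) * rval)}
      ≤ ENNReal.ofReal ((N + B.length) * (2 * Real.exp (-(c / 2)))) := by
  set κ := Real.exp (r ^ 2 / Real.sqrt d) with hκ
  have hκ0 : 0 < κ := Real.exp_pos _
  set ρ := κ * rval ^ 2 with hρ
  -- The exponent in R carries a factor 1/2, so R² is ρ, the bound on the squared feature norm of a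
  -- pair.
  have hthr : balanceThreshold n d r rval δ = c * ρ := by
    have e : Real.exp (r * r / (2 * Real.sqrt d)) * Real.exp (r * r / (2 * Real.sqrt d)) = κ := by
      rw [← Real.exp_add, hκ]
      ring_nf
    rw [balanceThreshold, balanceRadius, ← hc, hρ, ← e]
    ring
  have hρ0 : 0 ≤ ρ := by positivity
  have hG : Real.sqrt (ρ * κ) = κ * rval := by
    rw [hρ, show κ * rval ^ 2 * κ = (κ * rval) ^ 2 by ring, Real.sqrt_sq (by positivity)]
  set Bad : List (KV d s × Bool) → Prop := fun sg => sg.map Prod.fst = B ∧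
    ∃ j, Real.sqrt s * c * (κ * rval) < ‖signedSum (q j) sg‖ with hBad
  obtain ⟨L₀, hM, hL₀⟩ : ∃ L₀ : List ((KV d s →₀ ℝ) × ℝ),
      expMass (kvForm d s) (c * ρ) L₀ ≤ N * (2 * Real.exp (-(c / 2))) ∧
      ∀ sg, Bad sg → 1 ≤ expSum (kvForm d s) L₀ (walk sg) := by
    -- With radius 0 all values vanish, and so do the signed sums of lists with underlying pairs
    -- `B`; no detector is needed. This is why `Bad` records those pairs.
    rcases hrval.eq_or_lt with h0 | h0
    · refine ⟨[], ?_, ?_⟩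
      · simp only [expMass, List.map_nil, List.sum_nil]
        positivity
      · rintro sg ⟨hsg, j, hj⟩
        rw [signedSum_eq_zero, norm_zero, ← h0] at hj
        · simp at hj
        · intro x hx
          rw [hsg] at hx
          exact norm_le_zero_iff.1 (h0 ▸ hBv x hx)
    · have hρ1 : 0 < ρ := by positivity
      refine ⟨detector s c (Real.sqrt (ρ * κ))⁻¹ q, expMass_detector_le hs (by linarith) hρ1 hκ0 q
        fun j => softmaxKernel_self_le (hq j), ?_⟩
      rintro sg ⟨-, j, hj⟩
      rw [← hG] at hj
      exact one_le_expSum_detector hs (by linarith) (Real.sqrt_pos.2 (by positivity)) q sg j hj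
  have hxs : ∀ x ∈ B, kvForm d s (Finsupp.single x 1) (Finsupp.single x 1) ≤ ρ := by
    intro x hx
    rw [kvForm_single, one_mul, one_mul, real_inner_self_eq_norm_sq, hρ]
    gcongr
    · exact softmaxKernel_self_le (hBk x hx)
    · exact hBv x hx
  obtain ⟨L, hL, h⟩ := exists_expSum_assignSigns hc1 hρ0 Bad L₀ hL₀ B hxs
  rw [softmaxBalance_apply, hthr, ← add_zero (ENNReal.ofReal _)]
  refine PMF.toOuterMeasure_bind_le ((h [] _).trans (ENNReal.ofReal_le_ofReal ?_)) ?_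
  · have h0 := expSum_zero_le (by positivity : (0 : ℝ) ≤ c * ρ) kvForm_self_nonneg L
    simp only [walk, List.map_nil, List.sum_nil]
    linarith
  · rintro ⟨o, m'⟩ hy hyT
    simp only [Set.mem_ofPred_eq, not_forall] at hyT
    obtain ⟨sg, rfl, hsg⟩ := hyT
    have hB : sg.map Prod.fst = B := by
      simpa using (assignSigns_support _ _ _ _ _ hy).2.2.2 sg rfl
    rw [PMF.toOuterMeasure_pure_eq_zero]
    simp only [Set.mem_ofPred_eq, not_not]
    refine ⟨_, rfl, fun j => ?_⟩
    rw [← hB, norm_kernelSum_sub_smallerClass]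
    by_contra hlt
    exact hsg ⟨hB, j, not_le.1 hlt⟩

theorem foldl_max_spec (B : List (KV d s)) (a : ℝ) :
    a ≤ B.foldl (fun acc x => max acc ‖x.2‖) a ∧
      (∀ x ∈ B, ‖x.2‖ ≤ B.foldl (fun acc x => max acc ‖x.2‖) a) ∧
      ∀ V, a ≤ V → (∀ x ∈ B, ‖x.2‖ ≤ V) → B.foldl (fun acc x => max acc ‖x.2‖) a ≤ V := by
  induction B generalizing a with
  | nil => simp
  | cons x B ih =>
    obtain ⟨h1, h2, h3⟩ := ih (max a ‖x.2‖)
    refine ⟨(le_max_left _ _).trans h1, ?_, fun V ha hV => ?_⟩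
    · intro y hy
      rcases List.mem_cons.1 hy with rfl | hy
      · exact (le_max_right _ _).trans h1
      · exact h2 y hy
    · exact h3 V (max_le ha (hV x List.mem_cons_self)) fun y hy => hV y (List.mem_cons_of_mem _ hy)

theorem maxValueNorm_nonneg (B : List (KV d s)) : 0 ≤ maxValueNorm B := (foldl_max_spec B 0).1

theorem le_maxValueNorm (B : List (KV d s)) : ∀ x ∈ B, ‖x.2‖ ≤ maxValueNorm B :=
  (foldl_max_spec B 0).2.1

theorem maxValueNorm_le {B : List (KV d s)} {V : ℝ} (hV : 0 ≤ V) (h : ∀ x ∈ B, ‖x.2‖ ≤ V) :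
    maxValueNorm B ≤ V := (foldl_max_spec B 0).2.2 V hV h

/-! ### Moving the survivors of a level to the next one -/

/-- The level subsets after level `i` has been replaced by the survivors `out` on level `i + 1`. -/
def promote (C : Levels d s) (i : ℕ) (out : List (KV d s)) : Levels d s :=
  Function.update (Function.update C (i + 1) (C (i + 1) ++ out)) i []

theorem promote_self (C : Levels d s) (i : ℕ) (out : List (KV d s)) : promote C i out i = [] := by
  simp [promote]

theorem promote_succ (C : Levels d s) (i : ℕ) (out : List (KV d s)) :
    promote C i out (i + 1) = C (i + 1) ++ out := by
  simp [promote]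

theorem promote_of_ne (C : Levels d s) {i l : ℕ} (out : List (KV d s)) (h1 : l ≠ i)
    (h2 : l ≠ i + 1) : promote C i out l = C l := by
  simp [promote, h1, h2]

theorem sum_range_eq_add_erase {A : Type*} [AddCommMonoid A] (f : ℕ → A) {i N : ℕ}
    (h : i + 1 < N) :
    ∑ l ∈ Finset.range N, f l
      = (f i + f (i + 1)) + ∑ l ∈ ((Finset.range N).erase i).erase (i + 1), f l := by
  rw [← Finset.add_sum_erase _ f (Finset.mem_range.2 ((Nat.lt_succ_self i).trans h)),
    ← Finset.add_sum_erase ((Finset.range N).erase i) f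
      (Finset.mem_erase.2 ⟨Nat.succ_ne_self i, Finset.mem_range.2 h⟩), add_assoc]

/-- A promotion changes two levels only. Weight, stored tokens, word count and estimate are all sums
over levels, so this one splitting serves them all. -/
theorem sum_promote {A : Type*} [AddCommMonoid A] (g : ℕ → List (KV d s) → A) (C : Levels d s)
    {i N : ℕ} (h : i + 1 < N) (out : List (KV d s)) :
    ∑ l ∈ Finset.range N, g l (promote C i out l)
      = (g i [] + g (i + 1) (C (i + 1) ++ out))
        + ∑ l ∈ ((Finset.range N).erase i).erase (i + 1), g l (C l) := by
  rw [sum_range_eq_add_erase _ h, promote_self, promote_succ]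
  congr 1
  refine Finset.sum_congr rfl fun l hl => ?_
  simp only [Finset.mem_erase] at hl
  rw [promote_of_ne C out hl.2.1 hl.1]

/-- The number of tokens represented by the levels up to `i`. -/
def weight (C : Levels d s) (i : ℕ) : ℕ := ∑ l ∈ Finset.range (i + 1), 2 ^ l * (C l).length

theorem pow_mul_length_le_weight (C : Levels d s) {l i : ℕ} (h : l ≤ i) :
    2 ^ l * (C l).length ≤ weight C i :=
  Finset.single_le_sum (f := fun l => 2 ^ l * (C l).length) (fun _ _ => Nat.zero_le _)
    (Finset.mem_range.2 (Nat.lt_succ_of_le h))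

/-- At least half of the pairs disappear while the weight of each survivor doubles. -/
theorem weight_promote_le (C : Levels d s) {i i' : ℕ} (h : i < i') {out : List (KV d s)}
    (ho : 2 * out.length ≤ (C i).length) : weight (promote C i out) i' ≤ weight C i' := by
  rw [weight, weight, sum_promote (fun l B => 2 ^ l * B.length) C (Nat.succ_lt_succ h),
    sum_range_eq_add_erase _ (Nat.succ_lt_succ h)]
  refine Nat.add_le_add_right ?_ _
  rw [List.length_append, List.length_nil, pow_succ]
  nlinarith [Nat.mul_le_mul_left (2 ^ i) ho]

theorem weight_eq_zero {C : Levels d s} {i : ℕ} (h : ∀ l ≤ i, C l = []) : weight C i = 0 :=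
  Finset.sum_eq_zero fun l hl => by rw [h l (Nat.lt_succ_iff.1 (Finset.mem_range.1 hl))]; simp

/-- All stored pairs, with multiplicity. -/
def tokens (T : ℕ) (C : Levels d s) : Multiset (KV d s) :=
  ∑ l ∈ Finset.range (T + 1), (C l : Multiset (KV d s))

theorem coe_flatMap_range (C : Levels d s) (N : ℕ) :
    (((List.range N).flatMap C : List (KV d s)) : Multiset (KV d s))
      = ∑ l ∈ Finset.range N, (C l : Multiset (KV d s)) := by
  induction N with
  | zero => simp
  | succ N ih =>
    rw [List.range_succ, List.flatMap_append, ← Multiset.coe_add, ih, Finset.sum_range_succ]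
    simp

theorem coe_le_tokens (C : Levels d s) {l T : ℕ} (h : l ≤ T) :
    (C l : Multiset (KV d s)) ≤ tokens T C :=
  Finset.single_le_sum (f := fun l => (C l : Multiset (KV d s))) (fun _ _ => Multiset.zero_le _)
    (Finset.mem_range.2 (Nat.lt_succ_of_le h))

theorem card_tokens (T : ℕ) (C : Levels d s) :
    (tokens T C).card = ∑ l ∈ Finset.range (T + 1), (C l).length := by
  simp [tokens, Multiset.card_sum]

theorem tokens_promote_le (C : Levels d s) {i T : ℕ} (h : i < T) {out : List (KV d s)}
    (ho : out.Sublist (C i)) : tokens T (promote C i out) ≤ tokens T C := by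
  rw [tokens, tokens, sum_promote (fun _ B => (B : Multiset (KV d s))) C (Nat.succ_lt_succ h),
    sum_range_eq_add_erase _ (Nat.succ_lt_succ h)]
  refine add_le_add ?_ le_rfl
  rw [← Multiset.coe_add, Multiset.coe_nil, zero_add, add_comm]
  exact add_le_add (Multiset.coe_le.2 ho.subperm) le_rfl

theorem card_tokens_promote (C : Levels d s) {i T : ℕ} (h : i < T) (out : List (KV d s)) :
    (tokens T (promote C i out)).card + (C i).length = (tokens T C).card + out.length := by
  rw [card_tokens, card_tokens, sum_promote (fun _ B => B.length) C (Nat.succ_lt_succ h),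
    sum_range_eq_add_erase _ (Nat.succ_lt_succ h), List.length_append, List.length_nil]
  omega

theorem estimate_eq (T : ℕ) (C : Levels d s) (q : EuclideanSpace ℝ (Fin d)) :
    estimate T C q = ∑ l ∈ Finset.range (T + 1), (2 : ℝ) ^ l • kernelSum q (C l) := rfl

theorem estimate_promote (C : Levels d s) {i T : ℕ} (h : i < T) (out : List (KV d s))
    (q : EuclideanSpace ℝ (Fin d)) :
    estimate T C q - estimate T (promote C i out) q
      = (2 : ℝ) ^ i • (kernelSum q (C i) - (2 : ℝ) • kernelSum q out) := by
  rw [estimate_eq, estimate_eq, sum_promote (fun l B => (2 : ℝ) ^ l • kernelSum q B) C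
    (Nat.succ_lt_succ h), sum_range_eq_add_erase _ (Nat.succ_lt_succ h), kernelSum_append,
    kernelSum_nil, pow_succ]
  module

/-! ### Invariants -/

/-- The invariant at the end of step `j`: the levels up to `i < T` only represent the tokens read
since level `i` was emptied for the last time. -/
structure StepInv (t T j : ℕ) (C : Levels d s) : Prop where
  weight_le_mod : ∀ i < T, weight C i ≤ j % (t * 2 ^ i)
  weight_le : weight C T ≤ j

/-- The invariant inside step `j + 1` when the loop has reached level `i`. -/
structure CascadeInv (t T j i : ℕ) (C : Levels d s) : Prop where
  empty : ∀ l < i, C l = []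
  weight_le_mod : ∀ l, i ≤ l → l < T → weight C l ≤ j % (t * 2 ^ l) + 1
  weight_le : weight C T ≤ j + 1

theorem CascadeInv.length_le {t T j i : ℕ} {C : Levels d s} (h : CascadeInv t T j i C)
    (ht : 0 < t) (hj : j + 1 ≤ t * 2 ^ T) {l : ℕ} (hl : l ≤ T) : (C l).length ≤ t := by
  have hpos : 0 < 2 ^ l := by positivity
  rcases lt_or_ge l i with hi | hi
  · rw [h.empty l hi]; simp
  refine Nat.le_of_mul_le_mul_left (c := 2 ^ l) ?_ hpos
  refine (pow_mul_length_le_weight C le_rfl).trans ?_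
  rw [mul_comm]
  rcases hl.lt_or_eq with hl | rfl
  -- The residue plus one is still at most t·2^l, so the bound t survives the token just read.
  · exact (h.weight_le_mod l hi hl).trans (Nat.mod_lt _ (by positivity))
  · exact h.weight_le.trans hj

theorem StepInv.length_le {t T j : ℕ} {C : Levels d s} (h : StepInv t T j C)
    (ht : 0 < t) (hj : j ≤ t * 2 ^ T) {l : ℕ} (hl : l ≤ T) : (C l).length ≤ t := by
  have hpos : 0 < 2 ^ l := by positivity
  refine Nat.le_of_mul_le_mul_left (c := 2 ^ l) ?_ hpos
  refine (pow_mul_length_le_weight C le_rfl).trans ?_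
  rw [mul_comm]
  rcases hl.lt_or_eq with hl | rfl
  · exact (h.weight_le_mod l hl).trans (Nat.mod_lt _ (by positivity)).le
  · exact h.weight_le.trans hj

theorem card_tokens_le {t T : ℕ} {C : Levels d s} (h : ∀ l ≤ T, (C l).length ≤ t) :
    (tokens T C).card ≤ (T + 1) * t := by
  rw [card_tokens]
  refine (Finset.sum_le_card_nsmul _ _ t fun l hl => h l ?_).trans (by simp)
  exact Nat.lt_succ_iff.1 (Finset.mem_range.1 hl)

theorem CascadeInv.promote {t T j i : ℕ} {C : Levels d s} (h : CascadeInv t T j i C) (hi : i < T)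
    {out : List (KV d s)} (ho : 2 * out.length ≤ (C i).length) :
    CascadeInv t T j (i + 1) (promote C i out) where
  empty l hl := by
    rcases (Nat.lt_succ_iff.1 hl).lt_or_eq with hl | rfl
    · rw [promote_of_ne C out (by omega) (by omega), h.empty l hl]
    · exact promote_self C l out
  weight_le_mod l hl hlT :=
    (weight_promote_le C hl ho).trans (h.weight_le_mod l (by omega) hlT)
  weight_le := (weight_promote_le C hi ho).trans h.weight_le

theorem succ_mod_of_not_dvd {j b : ℕ} (h : ¬ b ∣ j + 1) : (j + 1) % b = j % b + 1 := by
  have h1 := Nat.div_add_mod j b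
  have h2 := Nat.div_add_mod (j + 1) b
  rw [Nat.succ_div_of_not_dvd h] at h2
  omega

/-- Levels below `i` have just been emptied. At the others no multiple of t·2^l is reached, so the
residue grows by exactly the one token read. -/
theorem CascadeInv.stepInv {t T j i : ℕ} {C : Levels d s} (h : CascadeInv t T j i C)
    (hndvd : ∀ l, i ≤ l → l < T → ¬ t * 2 ^ l ∣ j + 1) : StepInv t T (j + 1) C where
  weight_le_mod l hl := by
    rcases lt_or_ge l i with hi | hi
    · rw [weight_eq_zero fun l' hl' => h.empty l' (by omega)]
      exact Nat.zero_le _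
    · rw [succ_mod_of_not_dvd (hndvd l hi hl)]
      exact h.weight_le_mod l hi hl
  weight_le := h.weight_le

theorem StepInv.cascadeInv {t T j : ℕ} {C : Levels d s} (h : StepInv t T j C) (x : KV d s) :
    CascadeInv t T j 0 (Function.update C 0 (C 0 ++ [x])) := by
  have hw (i : ℕ) : weight (Function.update C 0 (C 0 ++ [x])) i = weight C i + 1 := by
    rw [weight, weight, Finset.sum_range_succ', Finset.sum_range_succ']
    simp
    omega
  exact ⟨by simp, fun l _ hl => by rw [hw]; exact Nat.succ_le_succ (h.weight_le_mod l hl),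
    by rw [hw]; exact Nat.succ_le_succ h.weight_le⟩

theorem tokens_update_zero (T : ℕ) (C : Levels d s) (x : KV d s) :
    tokens T (Function.update C 0 (C 0 ++ [x])) = tokens T C + {x} := by
  rw [tokens, tokens, Finset.sum_range_succ', Finset.sum_range_succ']
  simp only [Function.update_self, ne_eq, Nat.add_eq_zero_iff, one_ne_zero, and_false,
    not_false_eq_true, Function.update_of_ne]
  rw [← Multiset.coe_add, add_assoc]
  rfl

theorem estimate_update_zero (T : ℕ) (C : Levels d s) (x : KV d s)
    (q : EuclideanSpace ℝ (Fin d)) :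
    estimate T (Function.update C 0 (C 0 ++ [x])) q
      = estimate T C q + softmaxKernel x.1 q • x.2 := by
  rw [estimate_eq, estimate_eq, Finset.sum_range_succ', Finset.sum_range_succ']
  simp only [Function.update_self, ne_eq, Nat.add_eq_zero_iff, one_ne_zero, and_false,
    not_false_eq_true, Function.update_of_ne, kernelSum_append, kernelSum_cons, kernelSum_nil,
    pow_zero, one_smul, add_zero, add_assoc]

/-! ### The compression loop -/

theorem cascade_succ_apply (P : Params) (M i p : ℕ) (C : Levels d s) (m : Meter) :
    cascade P (M + 1) i p C m =
      (softmaxBalance P.n P.r (maxValueNorm (C i)) P.δ (C i)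
        (m.addTime ((C i).length * (2 * s + 2)))).bind fun y =>
        match y.1 with
        | none => PMF.pure (none, y.2)
        | some out =>
          if 2 ∣ p then
            cascade P M (i + 1) (p / 2) (promote C i out)
              ⟨y.2.time + (d + s) * (C i).length + 5, y.2.live - (d + s) * (C i).length, y.2.peak⟩
          else PMF.pure (some (promote C i out),
            ⟨y.2.time + (d + s) * (C i).length + 5, y.2.live - (d + s) * (C i).length,
              y.2.peak⟩) := by
  rw [cascade]
  simp only [RealRAM.Comp.bind_apply, valueRadius_apply, PMF.pure_bind]
  congr 1
  funext y
  rcases y with ⟨_ | out, m'⟩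
  · rfl
  · simp only [RealRAM.Comp.bind_apply, RealRAM.free_apply, RealRAM.tick_apply, PMF.pure_bind]
    split_ifs <;> rfl

/-- A bound on the time of one pass through the compression loop at level size at most `t`. -/
def passCost (d s t : ℕ) : ℕ :=
  t * (2 * s + 2) + (t * (t * (2 * d + 2 * s + 5) + 6) + 4 * t + 43 + (d + s) * t)
    + (d + s) * t + 5

/-- A bound on the number of words in use when `base` words are not taken by stored pairs. -/
def peakBound (d s t T base : ℕ) : ℕ := base + (d + s) * ((T + 1) * t) + (t + 16) + (d + s) * t

theorem dvd_next {t i p j : ℕ} (hp : t * 2 ^ i * p = j) (h2 : 2 ∣ p) :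
    t * 2 ^ (i + 1) * (p / 2) = j := by
  obtain ⟨k, rfl⟩ := h2
  rw [← hp, Nat.mul_div_cancel_left k two_pos, pow_succ]
  ring

/-- When the loop stops at an odd p, the level just emptied was the last one due in this step. -/
theorem not_dvd_of_odd {t i p j : ℕ} (ht : 0 < t) (hp : t * 2 ^ i * p = j) (h2 : ¬ 2 ∣ p) {l : ℕ}
    (hl : i + 1 ≤ l) : ¬ t * 2 ^ l ∣ j := by
  intro h
  have h3 : t * 2 ^ i * 2 ∣ t * 2 ^ i * p := by
    rw [hp]
    refine dvd_trans ?_ h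
    rw [mul_assoc, ← pow_succ]
    exact mul_dvd_mul_left t (pow_dvd_pow 2 hl)
  exact h2 (Nat.dvd_of_mul_dvd_mul_left (by positivity) h3)

theorem cascade_support {P : Params} (ht : 0 < P.t) {j base : ℕ} (hj : j + 1 ≤ P.t * 2 ^ P.T)
    (M i p : ℕ) (C : Levels d s) (m : Meter) (hM : i + M = P.T)
    (hp : P.t * 2 ^ i * p = j + 1) (hC : CascadeInv P.t P.T j i C)
    (hlive : m.live = base + (d + s) * (tokens P.T C).card)
    (hpeak : m.peak ≤ peakBound d s P.t P.T base) :
    ∀ y ∈ (cascade P M i p C m).support,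
      y.2.peak ≤ peakBound d s P.t P.T base ∧ y.2.time ≤ m.time + M * passCost d s P.t ∧
      ∀ C', y.1 = some C' → StepInv P.t P.T (j + 1) C' ∧ tokens P.T C' ≤ tokens P.T C ∧
        y.2.live = base + (d + s) * (tokens P.T C').card := by
  induction M generalizing i p C m with
  | zero =>
    intro y hy
    rw [cascade, RealRAM.Comp.pure_apply, PMF.mem_support_pure_iff] at hy
    subst hy
    refine ⟨hpeak, by simp, ?_⟩
    rintro C' hC'
    simp only [Option.some.injEq] at hC'
    subst hC'
    exact ⟨hC.stepInv fun l hl hl' => by omega, le_rfl, hlive⟩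
  | succ M ih =>
    intro y hy
    have hi : i < P.T := by omega
    have hlen := hC.length_le ht hj hi.le
    have hcard := card_tokens_le fun l hl => hC.length_le ht hj hl
    rw [cascade_succ_apply, PMF.mem_support_bind_iff] at hy
    obtain ⟨⟨o, m'⟩, ho, hy⟩ := hy
    obtain ⟨h1, h2, h3⟩ := softmaxBalance_support _ _ _ _ _ _ _ ho
    simp only [Meter.addTime_time, Meter.addTime_live, Meter.addTime_peak] at h1 h2 h3
    have hpk : m'.peak ≤ peakBound d s P.t P.T base := by
      refine h1.trans (max_le hpeak ?_)
      rw [hlive, peakBound]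
      gcongr
    have htime : m'.time + (d + s) * (C i).length + 5 ≤ m.time + passCost d s P.t := by
      have h4 : (C i).length * (2 * s + 2) ≤ P.t * (2 * s + 2) := by gcongr
      have h5 : (C i).length * ((C i).length * (2 * d + 2 * s + 5) + 6) + 4 * (C i).length + 43
          + (d + s) * (C i).length ≤ P.t * (P.t * (2 * d + 2 * s + 5) + 6) + 4 * P.t + 43
          + (d + s) * P.t := by gcongr
      have h6 : (d + s) * (C i).length ≤ (d + s) * P.t := by gcongr
      rw [passCost]
      omega
    have hMs : (M + 1) * passCost d s P.t = M * passCost d s P.t + passCost d s P.t := by ring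
    rcases o with _ | out
    · simp only [PMF.mem_support_pure_iff] at hy
      subst hy
      exact ⟨hpk, by simp only; omega, by simp⟩
    · obtain ⟨hsub, hhalf, hl⟩ := h3 out rfl
      have hC' := hC.promote hi hhalf
      have htok := tokens_promote_le C hi hsub
      have hlive' : m'.live - (d + s) * (C i).length
          = base + (d + s) * (tokens P.T (promote C i out)).card := by
        have := congrArg (fun x => (d + s) * x) (card_tokens_promote C hi out)
        simp only [Nat.mul_add (d + s)] at this
        rw [hl, hlive]
        omega
      simp only at hy
      split_ifs at hy with h2p
      · obtain ⟨k1, k2, k3⟩ := ih (i + 1) (p / 2) (promote C i out)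
          ⟨m'.time + (d + s) * (C i).length + 5, m'.live - (d + s) * (C i).length, m'.peak⟩
          (by omega) (dvd_next hp h2p) hC' hlive' hpk y hy
        refine ⟨k1, ?_, fun C' hc => ?_⟩
        · simp only at k2
          omega
        · obtain ⟨l1, l2, l3⟩ := k3 C' hc
          exact ⟨l1, l2.trans htok, l3⟩
      · rw [PMF.mem_support_pure_iff] at hy
        subst hy
        refine ⟨hpk, by simp only; omega, ?_⟩
        rintro C' hc
        simp only [Option.some.injEq] at hc
        subst hc
        exact ⟨hC'.stepInv fun l hl _ => not_dvd_of_odd ht hp h2p hl, htok, hlive'⟩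

/-- The total weight `2^l` of the levels `l ∈ [i, T)` that are compressed in step `j`. -/
def compressedWeight (t T j i : ℕ) : ℕ :=
  ∑ l ∈ Finset.Ico i T, if t * 2 ^ l ∣ j then 2 ^ l else 0

/-- The bound for one call holds for every fixed input list, so it applies conditionally on all
earlier coins and the failure probabilities add up. `A` carries the error weight accumulated so far.
-/
theorem cascade_bad_le {N : ℕ} {P : Params} {c V E : ℝ} {β : ℝ≥0∞} (hs : 0 < s)
    (hc : c = 30 * Real.log (P.n / P.δ)) (hc1 : 1 ≤ c)
    (hE : E = Real.sqrt s * c * (Real.exp (P.r ^ 2 / Real.sqrt d) * V)) (hV : 0 ≤ V)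
    (hβ : β = ENNReal.ofReal ((N + P.n) * (2 * Real.exp (-(c / 2)))))
    (q : Fin N → EuclideanSpace ℝ (Fin d)) (hq : ∀ j, ‖q j‖ ≤ P.r)
    (S : Fin N → EuclideanSpace ℝ (Fin s)) {j : ℕ}
    (M i p : ℕ) (C : Levels d s) (m : Meter) (hM : i + M = P.T)
    (hp : P.t * 2 ^ i * p = j + 1) (hC : CascadeInv P.t P.T j i C)
    (hn : (tokens P.T C).card ≤ P.n)
    (hk : ∀ x ∈ tokens P.T C, ‖x.1‖ ≤ P.r) (hv : ∀ x ∈ tokens P.T C, ‖x.2‖ ≤ V) {A : ℝ}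
    (hA : ∀ a, ‖S a - estimate P.T C (q a)‖ ≤ E * A) :
    (cascade P M i p C m).toOuterMeasure
      {y | ¬ ∃ C', y.1 = some C' ∧ ∀ a, ‖S a - estimate P.T C' (q a)‖
        ≤ E * (A + compressedWeight P.t P.T (j + 1) i)} ≤ M * β := by
  have hE0 : 0 ≤ E := by rw [hE]; positivity
  induction M generalizing i p C m A with
  | zero =>
    rw [cascade, RealRAM.Comp.pure_apply, PMF.toOuterMeasure_pure_eq_zero]
    · exact zero_le
    · simp only [Set.mem_ofPred_eq, not_not]
      refine ⟨C, rfl, fun a => (hA a).trans ?_⟩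
      gcongr
      simp
  | succ M ih =>
    have hi : i < P.T := by omega
    have hCi := coe_le_tokens C hi.le
    have hmem {x : KV d s} (hx : x ∈ C i) : x ∈ tokens P.T C :=
      Multiset.mem_of_le hCi (Multiset.mem_coe.2 hx)
    have hlen : (C i).length ≤ P.n := by
      have := Multiset.card_le_card hCi
      rw [Multiset.coe_card] at this
      exact this.trans hn
    have hbal := softmaxBalance_bad_le (n := P.n) hs (maxValueNorm_nonneg (C i)) hc hc1 q hq (C i)
      (fun x hx => hk x (hmem hx)) (le_maxValueNorm (C i)) (m.addTime ((C i).length * (2 * s + 2)))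
    have hcw : compressedWeight P.t P.T (j + 1) i
        = 2 ^ i + compressedWeight P.t P.T (j + 1) (i + 1) := by
      rw [compressedWeight, Finset.sum_eq_sum_Ico_succ_bot hi, if_pos ⟨p, hp.symm⟩,
        compressedWeight]
    have hMβ : ((M + 1 : ℕ) : ℝ≥0∞) * β = β + M * β := by
      push_cast
      ring
    rw [cascade_succ_apply, hMβ]
    refine PMF.toOuterMeasure_bind_le (hbal.trans ?_) ?_
    · rw [hβ]
      gcongr
    rintro ⟨o, m'⟩ ho hgood
    simp only [Set.mem_ofPred_eq, not_not] at hgood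
    obtain ⟨out, rfl, herr⟩ := hgood
    obtain ⟨hsub, hhalf, -⟩ := (softmaxBalance_support _ _ _ _ _ _ _ ho).2.2 out rfl
    have hC' := hC.promote hi hhalf
    have htok := tokens_promote_le C hi hsub
    have hA' (a : Fin N) : ‖S a - estimate P.T (promote C i out) (q a)‖ ≤ E * (A + 2 ^ i) := by
      have e : S a - estimate P.T (promote C i out) (q a)
          = (S a - estimate P.T C (q a))
            + (2 : ℝ) ^ i • (kernelSum (q a) (C i) - (2 : ℝ) • kernelSum (q a) out) := by
        rw [← estimate_promote C hi out (q a)]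
        abel
      rw [e, mul_add]
      refine (norm_add_le _ _).trans (add_le_add (hA a) ?_)
      rw [norm_smul, norm_pow, Real.norm_ofNat, mul_comm]
      gcongr
      refine (herr a).trans ?_
      rw [hE]
      gcongr
      -- The call used the largest norm on its own level; stored pairs are original tokens, so this
      -- is at most V.
      exact maxValueNorm_le hV fun x hx => hv x (hmem hx)
    simp only
    split_ifs with h2p
    · rw [hcw]
      push_cast
      simp only [← add_assoc]
      exact ih (i + 1) (p / 2) (promote C i out) _ (by omega) (dvd_next hp h2p) hC'
        ((Multiset.card_le_card htok).trans hn) (fun x hx => hk x (Multiset.mem_of_le htok hx))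
        (fun x hx => hv x (Multiset.mem_of_le htok hx)) hA'
    · rw [PMF.toOuterMeasure_pure_eq_zero]
      · exact zero_le
      · simp only [Set.mem_ofPred_eq, not_not]
        refine ⟨_, rfl, fun a => (hA' a).trans ?_⟩
        rw [hcw]
        push_cast
        -- The loop stops here, so the remaining weight is not needed; its nonnegativity suffices.
        have h0 : (0 : ℝ) ≤ compressedWeight P.t P.T (j + 1) (i + 1) := Nat.cast_nonneg _
        exact mul_le_mul_of_nonneg_left (by linarith) hE0

/-! ### One step of MergeAndReduce -/

theorem step_none_apply (P : Params) (x : KV d s) {st : State d s} (h : st.levels = none)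
    (m : Meter) : step P x st m = PMF.pure (⟨st.j + 1, none⟩, m.addTime 1) := by
  rcases st with ⟨j, lv⟩
  subst h
  simp [step, RealRAM.Comp.bind_apply, RealRAM.tick_apply, RealRAM.Comp.pure_apply]

theorem step_some_apply (P : Params) (x : KV d s) {st : State d s} {C : Levels d s}
    (h : st.levels = some C) (m : Meter) :
    step P x st m =
      ((if P.t ∣ st.j + 1 then
          cascade P P.T 0 ((st.j + 1) / P.t) (Function.update C 0 (C 0 ++ [x]))
        else pure (some (Function.update C 0 (C 0 ++ [x]))))
        (⟨m.time + (d + s) + 4, m.live + (d + s), max m.peak (m.live + (d + s))⟩ : Meter)).bind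
      fun y =>
        match y.1 with
        | none => PMF.pure (⟨st.j + 1, none⟩, y.2)
        | some C' => PMF.pure (⟨st.j + 1, some C'⟩,
            y.2.addTime (∑ i ∈ Finset.range (P.T + 1), ((d + s) * (C' i).length + 1))) := by
  rcases st with ⟨j, lv⟩
  subst h
  simp only [step]
  split_ifs
  all_goals
    simp only [RealRAM.Comp.bind_apply, RealRAM.alloc_apply, RealRAM.tick_apply, PMF.pure_bind]
    congr 1
    funext y
    rcases y with ⟨_ | C', m'⟩
    · rfl
    · simp only [RealRAM.Comp.bind_apply, RealRAM.tick_apply, PMF.pure_bind]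
      rfl

/-- A bound on the time of one step at level size at most `t`. -/
def stepCost (d s t T : ℕ) : ℕ :=
  (d + s) + 4 + T * passCost d s t + (T + 1) * ((d + s) * t + 1)

/-- The invariant of MergeAndReduce after the tokens `pre` have been read. -/
structure StateInv (P : Params) (pre : List (KV d s)) (st : State d s) (m : Meter) : Prop where
  j_eq : st.j = pre.length
  peak_le : m.peak ≤ peakBound d s P.t P.T (P.T + 25)
  stepInv : ∀ C, st.levels = some C → StepInv P.t P.T pre.length C
  tokens_le : ∀ C, st.levels = some C → tokens P.T C ≤ (pre : Multiset (KV d s))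
  live_eq : ∀ C, st.levels = some C → m.live = P.T + 25 + (d + s) * (tokens P.T C).card

theorem tokens_update_zero_le {T : ℕ} {C : Levels d s} {pre : List (KV d s)} (x : KV d s)
    (h : tokens T C ≤ (pre : Multiset (KV d s))) :
    tokens T (Function.update C 0 (C 0 ++ [x])) ≤ ((pre ++ [x] : List (KV d s)) : Multiset _) := by
  rw [tokens_update_zero, ← Multiset.coe_add]
  exact add_le_add h le_rfl

theorem StateInv.step {P : Params} (ht : 0 < P.t) {pre : List (KV d s)} {st : State d s}
    {m : Meter} (h : StateInv P pre st m) (hlen : pre.length + 1 ≤ P.t * 2 ^ P.T) (x : KV d s) :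
    ∀ y ∈ (step P x st m).support,
      StateInv P (pre ++ [x]) y.1 y.2 ∧ y.2.time ≤ m.time + stepCost d s P.t P.T := by
  intro y hy
  have hpre : (pre ++ [x]).length = pre.length + 1 := by simp
  rcases hlv : st.levels with _ | C
  · rw [step_none_apply P x hlv, PMF.mem_support_pure_iff] at hy
    subst hy
    refine ⟨⟨by rw [hpre, h.j_eq], h.peak_le, by simp, by simp, by simp⟩, ?_⟩
    simp only [Meter.addTime_time, stepCost]
    omega
  · rw [step_some_apply P x hlv, PMF.mem_support_bind_iff] at hy
    obtain ⟨⟨o, m'⟩, ho, hy⟩ := hy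
    have hC := (h.stepInv C hlv).cascadeInv x
    have htok := tokens_update_zero_le x (h.tokens_le C hlv)
    have hcard : (tokens P.T (Function.update C 0 (C 0 ++ [x]))).card
        = (tokens P.T C).card + 1 := by
      rw [tokens_update_zero]; simp
    set C₀ := Function.update C 0 (C 0 ++ [x]) with hC₀
    have hlive : m.live + (d + s) = P.T + 25 + (d + s) * (tokens P.T C₀).card := by
      rw [h.live_eq C hlv, hcard]
      ring
    have hpk : max m.peak (m.live + (d + s)) ≤ peakBound d s P.t P.T (P.T + 25) := by
      refine max_le h.peak_le ?_
      rw [hlive, peakBound]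
      have : (d + s) * (tokens P.T C₀).card ≤ (d + s) * ((P.T + 1) * P.t) :=
        Nat.mul_le_mul_left (d + s) (card_tokens_le fun l hl => hC.length_le ht hlen hl)
      omega
    have key : m'.peak ≤ peakBound d s P.t P.T (P.T + 25) ∧
        m'.time ≤ m.time + (d + s) + 4 + P.T * passCost d s P.t ∧
        ∀ C', o = some C' → StepInv P.t P.T (pre.length + 1) C' ∧
          tokens P.T C' ≤ tokens P.T C₀ ∧
          m'.live = P.T + 25 + (d + s) * (tokens P.T C').card := by
      rw [h.j_eq] at ho
      split_ifs at ho with hdvd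
      · exact cascade_support ht hlen P.T 0 _ C₀ _ (by simp)
          (by rw [pow_zero, mul_one, Nat.mul_div_cancel' hdvd]) hC hlive hpk _ ho
      · rw [RealRAM.Comp.pure_apply, PMF.mem_support_pure_iff, Prod.mk.injEq] at ho
        obtain ⟨rfl, rfl⟩ := ho
        refine ⟨hpk, Nat.le_add_right _ _, ?_⟩
        rintro C' hC'
        simp only [Option.some.injEq] at hC'
        subst hC'
        -- Off the multiples of t, no level is due for compression.
        exact ⟨hC.stepInv fun l _ _ hl => hdvd (dvd_trans (Dvd.intro _ rfl) hl), le_rfl, hlive⟩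
    obtain ⟨k1, k2, k3⟩ := key
    rcases o with _ | C'
    · simp only [PMF.mem_support_pure_iff] at hy
      subst hy
      refine ⟨⟨by rw [hpre, h.j_eq], k1, by simp, by simp, by simp⟩, ?_⟩
      simp only [stepCost]
      omega
    · simp only [PMF.mem_support_pure_iff] at hy
      subst hy
      obtain ⟨l1, l2, l3⟩ := k3 C' rfl
      refine ⟨⟨by rw [hpre, h.j_eq], k1, ?_, ?_, ?_⟩, ?_⟩
      · rintro _ ⟨rfl⟩
        rw [hpre]
        exact l1
      · rintro _ ⟨rfl⟩
        exact l2.trans htok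
      · rintro _ ⟨rfl⟩
        exact l3
      · have hout : ∑ i ∈ Finset.range (P.T + 1), ((d + s) * (C' i).length + 1)
            ≤ (P.T + 1) * ((d + s) * P.t + 1) := by
          refine (Finset.sum_le_card_nsmul _ _ ((d + s) * P.t + 1) fun i hi => ?_).trans (by simp)
          have := l1.length_le ht hlen (Nat.lt_succ_iff.1 (Finset.mem_range.1 hi))
          gcongr
        simp only [Meter.addTime_time, stepCost]
        omega

theorem trace_support {P : Params} (ht : 0 < P.t) (xs pre : List (KV d s)) (st : State d s)
    (m : Meter) (h : StateInv P pre st m) (hlen : (pre ++ xs).length ≤ P.t * 2 ^ P.T) :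
    ∀ tr ∈ (trace P xs st m).support, ∀ i < xs.length, ∃ rec : Record d s,
      tr[i]? = some rec ∧
      (∀ C, rec.output = some C →
        tokens P.T C ≤ ((pre ++ xs.take (i + 1) : List (KV d s)) : Multiset _)) ∧
      rec.peak ≤ peakBound d s P.t P.T (P.T + 25) ∧ rec.time ≤ stepCost d s P.t P.T := by
  induction xs generalizing pre st m with
  | nil => intro tr _ i hi; simp at hi
  | cons x xs ih =>
    intro tr htr i hi
    rw [trace, PMF.mem_support_bind_iff] at htr
    obtain ⟨y, hy, htr⟩ := htr
    rw [PMF.mem_support_map_iff] at htr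
    obtain ⟨l, hl, rfl⟩ := htr
    rw [List.length_append, List.length_cons] at hlen
    obtain ⟨hinv, htime⟩ := h.step ht (by omega) x y hy
    rcases i with _ | i
    · refine ⟨_, rfl, fun C hC => ?_, hinv.peak_le, Nat.sub_le_iff_le_add'.2 htime⟩
      simpa using hinv.tokens_le C hC
    · obtain ⟨rec, h1, h2⟩ := ih (pre ++ [x]) y.1 y.2 hinv
        (by simp only [List.length_append, List.length_cons, List.length_nil]; omega) l hl i
        (by simpa using hi)
      refine ⟨rec, by simpa using h1, ?_⟩
      simpa using h2

/-! ### Accumulation of the error -/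

/-- The total weight of the compressions made in the first `j` steps. -/
def totalWeight (t T j : ℕ) : ℕ := ∑ l ∈ Finset.range T, 2 ^ l * (j / (t * 2 ^ l))

/-- The floor of j/(t·2^l) increases by one exactly at the steps in which level l is compressed. -/
theorem totalWeight_succ (t T j : ℕ) :
    totalWeight t T (j + 1) = totalWeight t T j + compressedWeight t T (j + 1) 0 := by
  rw [totalWeight, totalWeight, compressedWeight, ← Finset.range_eq_Ico, ← Finset.sum_add_distrib]
  refine Finset.sum_congr rfl fun l _ => ?_
  rw [Nat.succ_div]
  split_ifs <;> ring

/-- A compression at level l costs 2^l but occurs only every t·2^l steps, so each level contributes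
at most j/t. -/
theorem totalWeight_mul_le (t T j : ℕ) : totalWeight t T j * t ≤ T * j := by
  rw [totalWeight, Finset.sum_mul]
  refine (Finset.sum_le_card_nsmul _ _ j fun l _ => ?_).trans (by simp)
  calc 2 ^ l * (j / (t * 2 ^ l)) * t = t * 2 ^ l * (j / (t * 2 ^ l)) := by ring
    _ ≤ j := Nat.mul_div_le _ _

/-- Storing the new token on level 0 is exact, so only compressions add error. -/
theorem step_bad_le {N : ℕ} {P : Params} {c V E : ℝ} {β : ℝ≥0∞} (hs : 0 < s)
    (hc : c = 30 * Real.log (P.n / P.δ)) (hc1 : 1 ≤ c)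
    (hE : E = Real.sqrt s * c * (Real.exp (P.r ^ 2 / Real.sqrt d) * V)) (hV : 0 ≤ V)
    (hβ : β = ENNReal.ofReal ((N + P.n) * (2 * Real.exp (-(c / 2)))))
    (q : Fin N → EuclideanSpace ℝ (Fin d)) (hq : ∀ j, ‖q j‖ ≤ P.r)
    {pre : List (KV d s)} {st : State d s} {m : Meter} (h : StateInv P pre st m)
    {C : Levels d s} (hC : st.levels = some C) {x : KV d s} (hn : pre.length + 1 ≤ P.n)
    (hk : ∀ y ∈ pre ++ [x], ‖y.1‖ ≤ P.r) (hv : ∀ y ∈ pre ++ [x], ‖y.2‖ ≤ V)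
    (herr : ∀ a, ‖kernelSum (q a) pre - estimate P.T C (q a)‖
      ≤ E * totalWeight P.t P.T pre.length) :
    (step P x st m).toOuterMeasure
      {y | ¬ ∃ C', y.1.levels = some C' ∧
        ∀ a, ‖kernelSum (q a) (pre ++ [x]) - estimate P.T C' (q a)‖
          ≤ E * totalWeight P.t P.T (pre ++ [x]).length} ≤ P.T * β := by
  have hE0 : 0 ≤ E := by rw [hE]; positivity
  have htok := tokens_update_zero_le x (h.tokens_le C hC)
  have hpre : (pre ++ [x]).length = pre.length + 1 := by simp
  have hinv := (h.stepInv C hC).cascadeInv x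
  have herr' (a : Fin N) : ‖kernelSum (q a) (pre ++ [x])
      - estimate P.T (Function.update C 0 (C 0 ++ [x])) (q a)‖
      ≤ E * totalWeight P.t P.T pre.length := by
    rw [estimate_update_zero, kernelSum_append, kernelSum_cons, kernelSum_nil, add_zero,
      add_sub_add_right_eq_sub]
    exact herr a
  set C₀ := Function.update C 0 (C 0 ++ [x]) with hC₀
  have hcard : (tokens P.T C₀).card ≤ P.n := by
    refine (Multiset.card_le_card htok).trans ?_
    rwa [Multiset.coe_card, hpre]
  rw [step_some_apply P x hC, hpre, totalWeight_succ, h.j_eq]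
  push_cast
  rw [← add_zero ((P.T : ℝ≥0∞) * β)]
  refine PMF.toOuterMeasure_bind_le (T := {y | ¬ ∃ C', y.1 = some C' ∧
    ∀ a, ‖kernelSum (q a) (pre ++ [x]) - estimate P.T C' (q a)‖ ≤ E *
      (totalWeight P.t P.T pre.length + compressedWeight P.t P.T (pre.length + 1) 0)}) ?_ ?_
  · split_ifs with hdvd
    · exact cascade_bad_le hs hc hc1 hE hV hβ q hq _ P.T 0 _ C₀ _ (by simp)
        (by rw [pow_zero, mul_one, Nat.mul_div_cancel' hdvd]) hinv hcard
        (fun y hy => hk y (Multiset.mem_coe.1 (Multiset.mem_of_le htok hy)))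
        (fun y hy => hv y (Multiset.mem_coe.1 (Multiset.mem_of_le htok hy))) herr'
    · rw [RealRAM.Comp.pure_apply, PMF.toOuterMeasure_pure_eq_zero]
      · exact zero_le
      · simp only [Set.mem_ofPred_eq, not_not]
        refine ⟨C₀, rfl, fun a => (herr' a).trans (mul_le_mul_of_nonneg_left ?_ hE0)⟩
        exact le_add_of_nonneg_right (Nat.cast_nonneg _)
  · rintro ⟨o, m'⟩ - hgood
    simp only [Set.mem_ofPred_eq, not_not] at hgood
    obtain ⟨C', rfl, hgood⟩ := hgood
    simp only
    rw [PMF.toOuterMeasure_pure_eq_zero]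
    simp only [Set.mem_ofPred_eq, not_not]
    exact ⟨C', rfl, hgood⟩

/-- The error is tracked at all queries in every step, because errors made now persist in the
estimates for later queries. -/
theorem trace_bad_le {N : ℕ} {P : Params} {c V E : ℝ} {β : ℝ≥0∞} (hs : 0 < s) (ht : 0 < P.t)
    (hc : c = 30 * Real.log (P.n / P.δ)) (hc1 : 1 ≤ c)
    (hE : E = Real.sqrt s * c * (Real.exp (P.r ^ 2 / Real.sqrt d) * V)) (hV : 0 ≤ V)
    (hβ : β = ENNReal.ofReal ((N + P.n) * (2 * Real.exp (-(c / 2)))))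
    (q : Fin N → EuclideanSpace ℝ (Fin d)) (hq : ∀ j, ‖q j‖ ≤ P.r)
    (hnT : P.n ≤ P.t * 2 ^ P.T)
    (xs pre : List (KV d s)) (st : State d s) (m : Meter) (h : StateInv P pre st m)
    (C : Levels d s) (hC : st.levels = some C) (hn : (pre ++ xs).length ≤ P.n)
    (hk : ∀ y ∈ pre ++ xs, ‖y.1‖ ≤ P.r) (hv : ∀ y ∈ pre ++ xs, ‖y.2‖ ≤ V)
    (herr : ∀ a, ‖kernelSum (q a) pre - estimate P.T C (q a)‖
      ≤ E * totalWeight P.t P.T pre.length) :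
    (trace P xs st m).toOuterMeasure
      {tr | ¬ ∀ i < xs.length, ∃ (rec : Record d s) (C' : Levels d s),
        tr[i]? = some rec ∧ rec.output = some C' ∧
        ∀ a, ‖kernelSum (q a) (pre ++ xs.take (i + 1)) - estimate P.T C' (q a)‖
          ≤ E * totalWeight P.t P.T (pre.length + (i + 1))} ≤ xs.length * (P.T * β) := by
  induction xs generalizing pre st m C with
  | nil =>
    rw [trace, PMF.toOuterMeasure_pure_eq_zero]
    · exact zero_le
    · simp
  | cons x xs ih =>
    rw [List.length_append, List.length_cons] at hn
    have happ : (pre ++ [x]) ++ xs = pre ++ x :: xs := by simp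
    have hsum : ((x :: xs).length : ℝ≥0∞) * (P.T * β) = P.T * β + xs.length * (P.T * β) := by
      push_cast [List.length_cons]
      ring
    rw [trace, hsum]
    refine PMF.toOuterMeasure_bind_le (step_bad_le hs hc hc1 hE hV hβ q hq h hC (by omega)
      (fun y hy => hk y ?_) (fun y hy => hv y ?_) herr) ?_
    · rw [← happ]; exact List.mem_append_left _ hy
    · rw [← happ]; exact List.mem_append_left _ hy
    rintro y hy hgood
    simp only [Set.mem_ofPred_eq, not_not] at hgood
    obtain ⟨C₁, hC₁, herr₁⟩ := hgood
    have hinv := (h.step ht (by omega) x y hy).1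
    have hrec := ih (pre ++ [x]) y.1 y.2 hinv C₁ hC₁
      (by simp only [List.length_append, List.length_cons, List.length_nil]; omega)
      (by rwa [happ]) (by rwa [happ]) herr₁
    rw [PMF.toOuterMeasure_map_apply]
    refine le_trans (MeasureTheory.measure_mono ?_) hrec
    intro l hl hgood
    refine hl fun i hi => ?_
    rcases i with _ | i
    · refine ⟨_, C₁, rfl, hC₁, ?_⟩
      simpa using herr₁
    · obtain ⟨rec, C', h1, h2, h3⟩ := hgood i (by simpa using hi)
      refine ⟨rec, C', by simpa using h1, h2, ?_⟩
      have e : (pre ++ [x]).length + (i + 1) = pre.length + (i + 1 + 1) := by simp; omega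
      rw [e] at h3
      simpa using h3

end KVCache

theorem PMF.ofReal_one_sub_le {α : Type*} {μ : PMF α} {S T : Set α} {x : ℝ} (hx : 0 ≤ x)
    (hT : μ.toOuterMeasure T ≤ ENNReal.ofReal x) (hST : ∀ a, a ∉ T → a ∈ S) :
    ENNReal.ofReal (1 - x) ≤ μ.toOuterMeasure S := by
  have h1 : μ.toOuterMeasure Set.univ = 1 := by
    rw [PMF.toOuterMeasure_apply, Set.indicator_univ, μ.tsum_coe]
  have h2 : μ.toOuterMeasure Set.univ ≤ μ.toOuterMeasure (S ∪ T) :=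
    MeasureTheory.measure_mono fun a _ => by
      by_cases ha : a ∈ T
      · exact Or.inr ha
      · exact Or.inl (hST a ha)
  rw [ENNReal.ofReal_sub 1 hx, ENNReal.ofReal_one, tsub_le_iff_right, ← h1]
  exact h2.trans ((MeasureTheory.measure_union_le S T).trans (by gcongr))

namespace KVCache

open RealRAM (Meter Comp)

variable {d s : ℕ}

/-! ### Estimates of the parameters -/

theorem peakBound_le {t T : ℕ} (ht : 0 < t) (hs : s ≤ d) (hd : 0 < d) :
    peakBound d s t T (T + 25) ≤ 46 * ((T + 1) * (d * t)) := by
  have h1 : 1 ≤ d * t := Nat.mul_pos hd ht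
  have h2 : t ≤ d * t := Nat.le_mul_of_pos_left t hd
  have h3 : s * t ≤ d * t := Nat.mul_le_mul_right t hs
  have h4 : d * t ≤ (T + 1) * (d * t) := Nat.le_mul_of_pos_left _ T.succ_pos
  have h5 : (T + 1) * (s * t) ≤ (T + 1) * (d * t) := Nat.mul_le_mul_left _ h3
  have h6 : T + 1 ≤ (T + 1) * (d * t) := Nat.le_mul_of_pos_right _ h1
  have e1 : (d + s) * ((T + 1) * t) = (T + 1) * (d * t) + (T + 1) * (s * t) := by ring
  have e2 : (d + s) * t = d * t + s * t := by ring
  rw [peakBound, e1, e2]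
  omega

theorem passCost_le {t : ℕ} (ht : 0 < t) (hs : s ≤ d) (hd : 0 < d) :
    passCost d s t ≤ 75 * (d * t ^ 2) := by
  have h0 : 1 ≤ t ^ 2 := Nat.succ_le_of_lt (by positivity)
  have h1 : t ≤ t ^ 2 := Nat.le_self_pow two_ne_zero t
  have h2 : s * t ^ 2 ≤ d * t ^ 2 := Nat.mul_le_mul_right _ hs
  have h3 : t ^ 2 ≤ d * t ^ 2 := Nat.le_mul_of_pos_left _ hd
  have h4 : d * t ≤ d * t ^ 2 := Nat.mul_le_mul_left _ h1
  have h5 : s * t ≤ s * t ^ 2 := Nat.mul_le_mul_left _ h1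
  rw [passCost]
  nlinarith

theorem stepCost_le {t T : ℕ} (ht : 0 < t) (hs : s ≤ d) (hd : 0 < d) :
    stepCost d s t T ≤ 84 * ((T + 1) * (d * t ^ 2)) := by
  have h0 : 1 ≤ t ^ 2 := Nat.succ_le_of_lt (by positivity)
  have h1 : t ≤ t ^ 2 := Nat.le_self_pow two_ne_zero t
  have h2 : d ≤ d * t ^ 2 := Nat.le_mul_of_pos_right _ h0
  have h3 : (d + s) * t ≤ 2 * (d * t ^ 2) := by
    calc (d + s) * t ≤ (d + d) * t ^ 2 := by gcongr
      _ = _ := by ring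
  have h4 : T * passCost d s t ≤ T * (75 * (d * t ^ 2)) :=
    Nat.mul_le_mul_left _ (passCost_le ht hs hd)
  have h5 : (T + 1) * ((d + s) * t + 1) ≤ (T + 1) * (3 * (d * t ^ 2)) := by
    gcongr
    omega
  have h6 : d * t ^ 2 ≤ (T + 1) * (d * t ^ 2) := Nat.le_mul_of_pos_left _ T.succ_pos
  have e1 : T * (75 * (d * t ^ 2)) + 75 * (d * t ^ 2) = 75 * ((T + 1) * (d * t ^ 2)) := by ring
  have e2 : (T + 1) * (3 * (d * t ^ 2)) = 3 * ((T + 1) * (d * t ^ 2)) := by ring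
  rw [stepCost]
  omega

theorem le_mul_two_pow_levels {n t : ℕ} (ht : 0 < t) :
    n ≤ t * 2 ^ ⌈Real.logb 2 ((n : ℝ) / t)⌉₊ := by
  rcases Nat.eq_zero_or_pos n with rfl | hn
  · exact Nat.zero_le _
  have ht' : (0 : ℝ) < t := by exact_mod_cast ht
  have hn' : (0 : ℝ) < n := by exact_mod_cast hn
  have h := Nat.le_ceil (Real.logb 2 ((n : ℝ) / t))
  rw [Real.logb_le_iff_le_rpow one_lt_two (by positivity), Real.rpow_natCast,
    div_le_iff₀ ht', mul_comm] at h
  exact_mod_cast h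

theorem half_lt_log {n : ℕ} (hn : 2 ≤ n) : 0.69 < Real.log n := by
  have h1 := Real.log_two_gt_d9
  have h2 : Real.log 2 ≤ Real.log n := Real.log_le_log two_pos (by exact_mod_cast hn)
  linarith

/-- Here 1/log 2 < 1.5, and log n > 0.69 lets the rounding term 1 be absorbed by 1.5·log n. For t >
n the logarithm is negative and the natural ceiling is 0. -/
theorem levels_le_log {n t : ℕ} (hn : 2 ≤ n) (ht : 0 < t) :
    (⌈Real.logb 2 ((n : ℝ) / t)⌉₊ : ℝ) ≤ 3 * Real.log n := by
  have hL := half_lt_log hn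
  have h2 := Real.log_two_gt_d9
  have ht' : (1 : ℝ) ≤ t := by exact_mod_cast ht
  have hn' : (0 : ℝ) < n := by positivity
  have h3 : Real.logb 2 ((n : ℝ) / t) ≤ Real.log n / Real.log 2 := by
    rw [← Real.log_div_log]
    have : Real.log ((n : ℝ) / t) ≤ Real.log n :=
      Real.log_le_log (by positivity) (div_le_self hn'.le ht')
    gcongr
  have h4 : Real.log n / Real.log 2 + 1 ≤ 3 * Real.log n := by
    have : Real.log n / Real.log 2 ≤ 1.5 * Real.log n := by
      rw [div_le_iff₀ (by linarith)]
      nlinarith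
    linarith
  rcases le_or_gt 0 (Real.logb 2 ((n : ℝ) / t)) with h | h
  · exact (Nat.ceil_lt_add_one h).le.trans (by linarith)
  · rw [Nat.ceil_eq_zero.2 h.le, Nat.cast_zero]
    linarith

theorem levels_le_self {n t : ℕ} (hn : 2 ≤ n) (ht : 0 < t) :
    ⌈Real.logb 2 ((n : ℝ) / t)⌉₊ ≤ n := by
  have ht' : (1 : ℝ) ≤ t := by exact_mod_cast ht
  have hn' : (0 : ℝ) < n := by positivity
  rw [Nat.ceil_le, Real.logb_le_iff_le_rpow one_lt_two (by positivity), Real.rpow_natCast]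
  exact (div_le_self hn'.le ht').trans (by exact_mod_cast Nat.lt_two_pow_self.le)

/-- The +1 from rounding up is absorbed because 3·L² ≥ 1. -/
theorem batch_real_bounds {L K X t : ℝ} (hL : 0.69 < L) (hK : 0 < K)
    (ht : t ≤ K * L ^ 2 * X + 1) : t ≤ (K + 3) * L ^ 2 * max 1 X := by
  have h1 : 1 ≤ 3 * L ^ 2 := by nlinarith
  have h2 : K * L ^ 2 * X ≤ K * L ^ 2 * max 1 X := by gcongr; exact le_max_right _ _
  have h3 : 3 * L ^ 2 * 1 ≤ 3 * L ^ 2 * max 1 X := by gcongr; exact le_max_left _ _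
  linarith

/-- The natural bound is linear in K+3 and cubic in L; it is padded to share its constant and
exponent with the time bound. -/
theorem memory_bound {L K X : ℝ} {T d t k : ℕ} (hL : 0.69 < L) (hK : 0 < K)
    (hT : (T : ℝ) ≤ 3 * L) (ht : (t : ℝ) ≤ (K + 3) * L ^ 2 * max 1 X)
    (hk : k ≤ 46 * ((T + 1) * (d * t))) :
    (k : ℝ) ≤ 700 * (K + 3) ^ 2 * L ^ 5 * (d * max 1 X) := by
  have h0 : 0 < max 1 X := lt_max_of_lt_left one_pos
  calc (k : ℝ) ≤ 46 * ((T + 1) * (d * t)) := by exact_mod_cast hk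
    _ ≤ 46 * ((5 * L) * (d * ((K + 3) * L ^ 2 * max 1 X))) := by
      gcongr
      linarith
    _ = 230 * (K + 3) * L ^ 3 * 1 * 1 * (d * max 1 X) := by ring
    _ ≤ 230 * (K + 3) * L ^ 3 * (3 * L ^ 2) * (K + 3) * (d * max 1 X) := by
      gcongr
      · nlinarith
      · linarith
    _ = 690 * (K + 3) ^ 2 * L ^ 5 * (d * max 1 X) := by ring
    _ ≤ _ := by
      gcongr
      norm_num

theorem time_bound {L K X : ℝ} {T d t k : ℕ} (hL : 0.69 < L) (hK : 0 < K) (hX : 0 ≤ X)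
    (hT : (T : ℝ) ≤ 3 * L) (ht : (t : ℝ) ≤ (K + 3) * L ^ 2 * max 1 X)
    (hk : k ≤ 84 * ((T + 1) * (d * t ^ 2))) :
    (k : ℝ) ≤ 700 * (K + 3) ^ 2 * L ^ 5 * (d * max 1 (X ^ 2)) := by
  have h0 : 0 < max 1 X := lt_max_of_lt_left one_pos
  have h1 : max 1 X ^ 2 = max 1 (X ^ 2) := by
    rcases le_total 1 X with h | h
    · rw [max_eq_right h, max_eq_right (one_le_pow₀ h)]
    · rw [max_eq_left h, max_eq_left (pow_le_one₀ hX h), one_pow]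
  rw [← h1]
  calc (k : ℝ) ≤ 84 * ((T + 1) * (d * (t : ℝ) ^ 2)) := by exact_mod_cast hk
    _ ≤ 84 * ((5 * L) * (d * ((K + 3) * L ^ 2 * max 1 X) ^ 2)) := by
      gcongr
      linarith
    _ = 420 * (K + 3) ^ 2 * L ^ 5 * (d * max 1 X ^ 2) := by ring
    _ ≤ _ := by
      gcongr
      norm_num

/-- With c = 30(a+1)·log n one has exp(-c/2) = n^(-15(a+1)). The union bound contributes a factor of
at most 4n³ ≤ n⁵, and a + 5 ≤ 15(a+1). -/
theorem failure_bound {n a T : ℕ} (hn : 2 ≤ n) (hT : T ≤ n) :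
    (n : ℝ) * (T * ((n + n) * (2 * Real.exp (-(30 * ((a + 1) * Real.log n) / 2)))))
      ≤ 1 / (n : ℝ) ^ a := by
  have hn2 : (2 : ℝ) ≤ n := by exact_mod_cast hn
  have hn0 : (0 : ℝ) < n := by linarith
  have he : Real.exp (-(30 * ((a + 1) * Real.log n) / 2)) = 1 / (n : ℝ) ^ (15 * (a + 1)) := by
    rw [Real.exp_neg, one_div]
    congr 1
    have e : 30 * (((a : ℝ) + 1) * Real.log n) / 2 = ((15 * (a + 1) : ℕ) : ℝ) * Real.log n := by
      push_cast
      ring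
    rw [e, Real.exp_nat_mul, Real.exp_log hn0]
  have hT' : (T : ℝ) ≤ n := by exact_mod_cast hT
  rw [he]
  calc (n : ℝ) * (T * ((n + n) * (2 * (1 / (n : ℝ) ^ (15 * (a + 1))))))
      ≤ n * (n * ((n + n) * (2 * (1 / (n : ℝ) ^ (15 * (a + 1)))))) := by gcongr
    _ = (n : ℝ) ^ 3 * 2 ^ 2 * (1 / (n : ℝ) ^ (15 * (a + 1))) := by ring
    _ ≤ (n : ℝ) ^ 3 * n ^ 2 * (1 / (n : ℝ) ^ (15 * (a + 1))) := by gcongr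
    _ = (n : ℝ) ^ 5 / (n : ℝ) ^ (15 * (a + 1)) := by ring
    _ ≤ 1 / (n : ℝ) ^ a := by
      rw [div_le_div_iff₀ (by positivity) (by positivity), one_mul, ← pow_add]
      exact pow_le_pow_right₀ (by linarith) (by omega)

theorem stateInv_init (P : Params) :
    StateInv P ([] : List (KV d s)) ⟨0, some fun _ => []⟩ ⟨0, P.T + 25, P.T + 25⟩ := by
  have htok : tokens P.T (fun _ => ([] : List (KV d s))) = 0 := by simp [tokens]
  refine ⟨rfl, ?_, ?_, ?_, ?_⟩
  · simp only [peakBound]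
    omega
  · rintro _ ⟨rfl⟩
    exact ⟨by simp [weight], by simp [weight]⟩
  · rintro _ ⟨rfl⟩
    rw [htok]
    exact Multiset.zero_le _
  · rintro _ ⟨rfl⟩
    rw [htok]
    simp

theorem kernelSum_take_ofFn {n : ℕ} (k : Fin n → EuclideanSpace ℝ (Fin d))
    (v : Fin n → EuclideanSpace ℝ (Fin s)) (q : EuclideanSpace ℝ (Fin d)) (j : Fin n) :
    kernelSum q ((List.ofFn fun i => (k i, v i)).take ((j : ℕ) + 1))
      = ∑ i ∈ Finset.Iic j, softmaxKernel (k i) q • v i := by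
  rw [kernelSum, List.map_take, List.map_ofFn, List.sum_take_ofFn]
  refine Finset.sum_congr ?_ fun i _ => rfl
  ext i
  simp only [Finset.mem_filter, Finset.mem_univ, true_and, Finset.mem_Iic, Fin.le_def,
    Nat.lt_succ_iff]

end KVCache

end

/-! ### Choice of constants and conclusion -/

open KVCache in
theorem theorem4 :
    ∃ m m' : ℕ, ∀ a : ℕ, ∃ (b : ℕ) (K K' : ℝ), 0 < K ∧ 0 < K' ∧
      ∀ (n d s : ℕ) (r ε : ℝ), 2 ≤ n → 1 ≤ s → s ≤ d → 0 < r → 0 < ε →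
      ∀ (q k : Fin n → EuclideanSpace ℝ (Fin d)) (v : Fin n → EuclideanSpace ℝ (Fin s)),
        (∀ j, ‖q j‖ ≤ r) → (∀ j, ‖k j‖ ≤ r) →
        ∀ P : KVCache.Params,
          P = KVCache.paramsFor n (KVCache.batchSize K m n d s r ε) b r →
        -- accuracy at all steps of the stream
        ENNReal.ofReal (1 - 1 / (n : ℝ) ^ a) ≤
          (KVCache.mergeAndReduce P (List.ofFn fun i => (k i, v i))).toOuterMeasure
            {tr | ∀ j : Fin n, ∃ (rec : KVCache.Record d s) (C : KVCache.Levels d s),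
              tr[(j : ℕ)]? = some rec ∧ rec.output = some C ∧
              ‖∑ i ∈ Finset.Iic j, KVCache.softmaxKernel (k i) (q j) • v i
                  - KVCache.estimate P.T C (q j)‖
                ≤ ε * ((j : ℕ) + 1) * Real.exp (-(r ^ 2 / Real.sqrt d)) * ⨆ i, ‖v i‖} ∧
        -- for all outcomes of the coins: the outputs are disjoint parts of the tokens read so far,
        -- and the bounds on memory and on the running time of each step hold
        ∀ tr ∈ (KVCache.mergeAndReduce P (List.ofFn fun i => (k i, v i))).support,
          ∀ j : Fin n, ∃ rec : KVCache.Record d s, tr[(j : ℕ)]? = some rec ∧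
            (∀ C, rec.output = some C →
              List.Subperm ((List.range (P.T + 1)).flatMap C)
                ((List.ofFn fun i => (k i, v i)).take ((j : ℕ) + 1))) ∧
            (rec.peak : ℝ) ≤ K' * Real.log n ^ m' *
              (d * max 1 (Real.sqrt s * Real.exp (2 * r ^ 2 / Real.sqrt d) / ε)) ∧
            (rec.time : ℝ) ≤ K' * Real.log n ^ m' *
              (d * max 1 (s * Real.exp (4 * r ^ 2 / Real.sqrt d) / ε ^ 2)) := by
  -- The exponent 2 counts one logarithm from c and one from T; 90(a+1) is 30(a+1) from c times 3
  -- from T ≤ 3·log n. The exponent 5 comes from (T+1)·t² in the running time.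
  refine ⟨2, 5, fun a => ⟨a, 90 * (a + 1), 700 * (90 * (a + 1) + 3) ^ 2, by positivity,
    by positivity, ?_⟩⟩
  intro n d s r ε hn hs hsd hr hε q k v hq hk P hP
  set K : ℝ := 90 * (a + 1) with hKdef
  have hK : 0 < K := by positivity
  set L := Real.log n with hLdef
  have hL : 0.69 < L := half_lt_log hn
  set X := Real.sqrt s * Real.exp (2 * r ^ 2 / Real.sqrt d) / ε with hXdef
  have hs' : (0 : ℝ) < s := by exact_mod_cast hs
  have hX : 0 < X := by positivity
  have hX2 : s * Real.exp (4 * r ^ 2 / Real.sqrt d) / ε ^ 2 = X ^ 2 := by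
    have e : Real.exp (4 * r ^ 2 / Real.sqrt d) = Real.exp (2 * r ^ 2 / Real.sqrt d) ^ 2 := by
      rw [← Real.exp_nat_mul]
      congr 1
      push_cast
      ring
    rw [hXdef, e, div_pow, mul_pow, Real.sq_sqrt hs'.le]
  have hPn : P.n = n := by rw [hP]; rfl
  have hPr : P.r = r := by rw [hP]; rfl
  have hPt : P.t = ⌈K * L ^ 2 * X⌉₊ := by rw [hP]; rfl
  have hPδ : P.δ = 1 / (n : ℝ) ^ a := by rw [hP]; rfl
  have hPT : P.T = ⌈Real.logb 2 ((n : ℝ) / P.t)⌉₊ := by rw [hP]; rfl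
  have hKLX : 0 < K * L ^ 2 * X := by positivity
  have ht : 0 < P.t := by rw [hPt]; exact Nat.ceil_pos.2 hKLX
  have htle : (P.t : ℝ) ≤ (K + 3) * L ^ 2 * max 1 X := by
    refine batch_real_bounds hL hK ?_
    rw [hPt]
    exact (Nat.ceil_lt_add_one hKLX.le).le
  have htge : K * L ^ 2 * X ≤ P.t := by rw [hPt]; exact Nat.le_ceil _
  have hTL : (P.T : ℝ) ≤ 3 * L := by rw [hPT]; exact levels_le_log hn ht
  have hTn : P.T ≤ n := by rw [hPT]; exact levels_le_self hn ht
  have hnT : n ≤ P.t * 2 ^ P.T := by rw [hPT]; exact le_mul_two_pow_levels ht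
  set stream := List.ofFn fun i => (k i, v i) with hstream
  have hlen : stream.length = n := by rw [hstream, List.length_ofFn]
  have hn0 : (0 : ℝ) < n := by positivity
  constructor
  · set V := ⨆ i, ‖v i‖ with hVdef
    have hV : 0 ≤ V := Real.iSup_nonneg fun i => norm_nonneg _
    have hvV (i : Fin n) : ‖v i‖ ≤ V :=
      le_ciSup (f := fun i => ‖v i‖) (Set.finite_range _).bddAbove i
    set c := 30 * (((a : ℝ) + 1) * L) with hcdef
    -- Taking b = a gives n/δ = n^(a+1).
    have hc : c = 30 * Real.log (P.n / P.δ) := by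
      rw [hPn, hPδ, div_div_eq_mul_div, div_one, ← pow_succ', Real.log_pow, hcdef]
      push_cast
      rfl
    have hc1 : 1 ≤ c := by
      have : 0 ≤ (a : ℝ) * L := by positivity
      rw [hcdef]
      nlinarith
    set E := Real.sqrt s * c * (Real.exp (r ^ 2 / Real.sqrt d) * V) with hE
    have hE0 : 0 ≤ E := by positivity
    have hmem {y : KV d s} (hy : y ∈ stream) : ∃ i, (k i, v i) = y := by
      simpa [hstream, List.mem_ofFn] using hy
    have hbad := trace_bad_le hs ht hc hc1 (by rw [hPr]) hV rfl q (by rwa [hPr]) (by rwa [hPn])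
      stream [] _ _ (stateInv_init P) _ rfl (by simp [hlen, hPn])
      (by
        rintro y hy
        obtain ⟨i, rfl⟩ := hmem (by simpa using hy)
        rw [hPr]
        exact hk i)
      (by
        rintro y hy
        obtain ⟨i, rfl⟩ := hmem (by simpa using hy)
        exact hvV i)
      (by
        intro b
        simp [estimate, totalWeight])
    refine PMF.ofReal_one_sub_le (by positivity) (hbad.trans ?_) ?_
    · rw [hlen, hPn, ← ENNReal.ofReal_natCast n, ← ENNReal.ofReal_natCast P.T,
        ← ENNReal.ofReal_mul (by positivity), ← ENNReal.ofReal_mul (by positivity)]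
      exact ENNReal.ofReal_le_ofReal (failure_bound hn hTn)
    · intro tr htr j
      simp only [Set.mem_ofPred_eq, not_not] at htr
      obtain ⟨rec, C, h1, h2, h3⟩ := htr j (by rw [hlen]; exact j.2)
      refine ⟨rec, C, h1, h2, ?_⟩
      have h4 := h3 j
      rw [List.nil_append, kernelSum_take_ofFn, List.length_nil, zero_add] at h4
      refine h4.trans ?_
      have ht' : (0 : ℝ) < P.t := by exact_mod_cast ht
      have hw : (totalWeight P.t P.T ((j : ℕ) + 1) : ℝ) * P.t ≤ P.T * ((j : ℕ) + 1) := by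
        exact_mod_cast totalWeight_mul_le P.t P.T ((j : ℕ) + 1)
      -- The factor exp(2r²/√d) in t covers exp(r²/√d) from E together with the factor exp(-r²/√d)
      -- demanded in the error bound.
      have hET : E * P.T ≤ ε * Real.exp (-(r ^ 2 / Real.sqrt d)) * V * P.t := by
        have e1 : Real.exp (-(r ^ 2 / Real.sqrt d)) * Real.exp (2 * r ^ 2 / Real.sqrt d)
            = Real.exp (r ^ 2 / Real.sqrt d) := by
          rw [← Real.exp_add]
          ring_nf
        calc E * P.T ≤ E * (3 * L) := by gcongr
          _ = ε * Real.exp (-(r ^ 2 / Real.sqrt d)) * V * (K * L ^ 2 * X) := by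
            rw [hE, ← e1, hXdef, hKdef, hcdef]
            field_simp
            ring
          _ ≤ _ := by gcongr
      refine le_of_mul_le_mul_right ?_ ht'
      calc E * totalWeight P.t P.T ((j : ℕ) + 1) * P.t
          = E * (totalWeight P.t P.T ((j : ℕ) + 1) * P.t) := by ring
        _ ≤ E * (P.T * ((j : ℕ) + 1)) := by gcongr
        _ = E * P.T * ((j : ℕ) + 1) := by ring
        _ ≤ ε * Real.exp (-(r ^ 2 / Real.sqrt d)) * V * P.t * ((j : ℕ) + 1) := by gcongr
        _ = _ := by ring
  · intro tr htr j
    obtain ⟨rec, h1, h2, h3, h4⟩ := trace_support ht stream [] _ _ (stateInv_init P)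
      (by simpa [hlen] using hnT) tr htr j (by rw [hlen]; exact j.2)
    have hd : 0 < d := by omega
    refine ⟨rec, h1, fun C hC => ?_, memory_bound hL hK hTL htle
      (h3.trans (peakBound_le ht hsd hd)), ?_⟩
    -- Disjointness with multiplicity is the multiset inequality for the sum of all levels.
    · rw [← Multiset.coe_le, coe_flatMap_range]
      exact h2 C hC
    · rw [hX2]
      exact time_bound hL hK hX.le hTL htle (h4.trans (stepCost_le ht hsd hd))
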